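/- Let $S^1=\mathbb R/\mathbb Z$ and let $s>5/2$. Let $H_0^s(S^1;\mathbb R)$ be the space of $u\in H^s(S^1;\mathbb R)$ with $u(0)=0$. Let $G^s$ be the Banach manifold of pairs $(\varphi,\alpha)$, where $\varphi=\mathrm{id}+h$ with $h\in H^s_0(S^1;\mathbb R)$ and $h_x>-1$, and $\alpha:S^1\to\mathbb R/4\pi\mathbb Z$ is of class $H^{s-1}$. Its tangent spaces are identified with $H^s_0(S^1;\mathbb R)\times H^{s-1}(S^1;\mathbb R)$, and it carries the right-invariant weak Riemannian metric $$\langle U,V\rangle_{(\varphi,\alpha)}=\langle U\circ\varphi^{-1},V\circ\varphi^{-1}\rangle_{(\mathrm{id},0)},\qquad \langle u,v\rangle_{(\mathrm{id},0)}=\tfrac14\int_{S^1}(u_{1x}v_{1x}+u_2v_2)\,dx.$$ A geodesic in $G^s$ on $[0,T)$, $0<T\le\infty$, is a curve $(\varphi,\alpha)\in C^\infty([0,T);G^s)$ satisfying $$(\varphi_{tt},\alpha_{tt})=\Gamma_{(\varphi,\alpha)}\big((\varphi_t,\alpha_t),(\varphi_t,\alpha_t)\big),$$ where $\Gamma$ is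 the Christoffel map of the metric: it is right-invariant, i.e. $\Gamma_{(\varphi,\alpha)}(u\circ\varphi,v\circ\varphi)=\Gamma_{(\mathrm{id},0)}(u,v)\circ\varphi$, and $$\Gamma_{(\mathrm{id},0)}(u,v)=-\tfrac12\big(A^{-1}\partial_x(u_{1x}v_{1x}+u_2v_2),\;u_{1x}v_2+v_{1x}u_2\big),$$ $$(A^{-1}f)(x)=-\int_0^x\!\int_0^y f(z)\,dz\,dy+x\int_0^1\!\int_0^y f(z)\,dz\,dy .$$ Let $\Phi(\varphi,\alpha)=\sqrt{\varphi_x}\,e^{i\alpha/2}$, a map on $G^s$ with values in the set $\mathcal U^{s-1}$ of nowhere vanishing $f\in H^{s-1}(S^1;\mathbb C)$ with $\int_{S^1}|f|^2dx=1$. Let $(u_0,\rho_0)\in H^s_0(S^1;\mathbb R)\times H^{s-1}(S^1;\mathbb R)$ with $(u_0,\rho_0)\ne(0,0)$, and let $c>0$ be given by $c^2=\frac14\int_{S^1}(u_{0x}^2+\rho_0^2)\,dx$. Then there is a geodesic $(\varphi(t),\alpha(t))$ in $G^s$ with $(\varphi(0),\alpha(0))=(\mathrm{id},0)$ and $(\varphi_t(0),\alpha_t(0))=(u_0,\rho_0)$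 that is defined on a maximal interval $[0,T_s)$, $0<T_s\le\infty$ (it does not extend to a geodesic on a longer interval $[0,T')$). For every such maximal geodesic the following hold. 1. Its speed is $c$: $\langle(\varphi_t,\alpha_t),(\varphi_t,\alpha_t)\rangle_{(\varphi,\alpha)}=c^2$ for all $t\in[0,T_s)$. 2. For all $t\in[0,T_s)$, the function $\cos ct+\frac{u_{0x}+i\rho_0}{2c}\sin ct$ belongs to $\mathcal U^{s-1}$, and $(\varphi(t),\alpha(t))$ is its unique preimage under $\Phi$: $$(\varphi(t),\alpha(t))=\Phi^{-1}\Big(\cos ct+\frac{u_{0x}+i\rho_0}{2c}\sin ct\Big).$$ 3. That is, for all $t\in[0,T_s)$ and all $x$, $$\varphi(t,x)=\int_0^x\Big\{\Big(\cos ct+\frac{u_{0x}(y)}{2c}\sin ct\Big)^2+\Big(\frac{\rho_0(y)}{2c}\sin ct\Big)^2\Big\}\,dy,$$ $$\alpha(t,x)=2\arg\Big(\cos ct+\frac{u_{0x}(x)+i\rho_0(x)}{2c}\sin ct\Big)\pmod{4\pi}.$$ 4. The maximal existence time does not depend on the Sobolev index: for every $r\in(5/2,s]$ there is a maximal geodesic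 in $G^r$ with the same initial data, and every such geodesic has maximal existence time $T_r=T_s$. 5. The geodesic is global, i.e. $T_s=\infty$, if and only if $\rho_0(x)\neq0$ for all $x\in S^1$. -/

import Mathlib

open MeasureTheory Set Filter
open scoped Topology ContDiff ENNReal

/-! Functions on the circle `S¹` of length one are represented by `1`-periodic functions on `ℝ`. -/

namespace HunterSaxton

noncomputable section

/-! ### Sobolev spaces on the circle -/

/-- The `n`-th Fourier coefficient `∫₀¹ e^{-2πinx} f(x) dx` of a `1`-periodic function. -/
def coeff (f : ℝ → ℂ) (n : ℤ) : ℂ :=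
  ∫ x in (0 : ℝ)..1, fourier (-n) (x : UnitAddCircle) * f x

/-- The weighted Fourier coefficients `(1 + n²)^{σ/2} f̂(n)`. -/
def weightedCoeff (σ : ℝ) (f : ℝ → ℂ) (n : ℤ) : ℂ :=
  (((1 + (n : ℝ) ^ 2) ^ (σ / 2) : ℝ) : ℂ) * coeff f n

/-- `f` is (the continuous representative of) an element of `H^σ(S¹; ℂ)`, i.e.
`∑ₙ (1 + n²)^σ |f̂(n)|² < ∞`.  Only used for `σ > 1/2`, where every class in `H^σ`
has exactly one continuous representative. -/
structure MemSobolev (σ : ℝ) (f : ℝ → ℂ) : Prop where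
  continuous : Continuous f
  periodic : Function.Periodic f 1
  memℓp : Memℓp (weightedCoeff σ f) 2

theorem coeff_add {f g : ℝ → ℂ} (hf : Continuous f) (hg : Continuous g) (n : ℤ) :
    coeff (fun x => f x + g x) n = coeff f n + coeff g n := by
  have hk : Continuous fun x : ℝ => (fourier (-n) (x : UnitAddCircle) : ℂ) :=
    (map_continuous (fourier (T := 1) (-n))).comp (AddCircle.continuous_mk' 1)
  simp only [coeff, mul_add]
  exact intervalIntegral.integral_add ((hk.mul hf).intervalIntegrable _ _)
    ((hk.mul hg).intervalIntegrable _ _)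

theorem coeff_smul (a : ℂ) (f : ℝ → ℂ) (n : ℤ) :
    coeff (fun x => a * f x) n = a * coeff f n := by
  simp only [coeff]
  rw [← intervalIntegral.integral_const_mul]
  congr 1
  ext x
  ring

theorem weightedCoeff_add (σ : ℝ) {f g : ℝ → ℂ} (hf : Continuous f) (hg : Continuous g) :
    weightedCoeff σ (fun x => f x + g x) = weightedCoeff σ f + weightedCoeff σ g := by
  ext n
  simp [weightedCoeff, coeff_add hf hg, mul_add]

theorem weightedCoeff_smul (σ : ℝ) (a : ℂ) (f : ℝ → ℂ) :
    weightedCoeff σ (fun x => a * f x) = a • weightedCoeff σ f := by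
  ext n
  simp only [weightedCoeff, coeff_smul, Pi.smul_apply, smul_eq_mul]
  ring

/-- A continuous periodic function is determined by its Fourier coefficients. -/
theorem eq_zero_of_coeff {f : ℝ → ℂ} (hf : Continuous f) (hp : Function.Periodic f 1)
    (h : ∀ n, coeff f n = 0) : f = 0 := by
  let F : C(UnitAddCircle, ℂ) := ⟨hp.lift, continuous_coinduced_dom.mpr hf⟩
  have hF : ∀ x : ℝ, F (x : UnitAddCircle) = f x := fun x => hp.lift_coe x
  have h0 : fourierCoeff (F : UnitAddCircle → ℂ) = 0 := by
    ext n
    rw [fourierCoeff_eq_intervalIntegral _ n 0]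
    have := h n
    simp only [coeff] at this
    simpa [hF] using this
  ext x
  have hs := has_pointwise_sum_fourier_series_of_summable (f := F)
    (by rw [h0]; exact summable_zero) (x : UnitAddCircle)
  rw [h0] at hs
  simp only [Pi.zero_apply, zero_smul] at hs
  rw [← hF x]
  exact hs.unique hasSum_zero

/-- `H^σ(S¹; ℝ)` as a space of periodic functions. -/
def sobolevSubmodule (σ : ℝ) : Submodule ℝ (ℝ → ℝ) where
  carrier := {f | MemSobolev σ fun x => (f x : ℂ)}
  zero_mem' := by
    refine ⟨by simpa using continuous_const, by intro x; simp, ?_⟩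
    have : weightedCoeff σ (fun x => (((0 : ℝ → ℝ) x : ℝ) : ℂ)) = 0 := by
      ext n; simp [weightedCoeff, coeff]
    rw [this]
    exact zero_memℓp
  add_mem' := by
    intro f g hf hg
    have e : (fun x => (((f + g) x : ℝ) : ℂ)) = fun x => (f x : ℂ) + (g x : ℂ) := by
      ext x; simp
    show MemSobolev σ _
    rw [e]
    refine ⟨hf.continuous.add hg.continuous, hf.periodic.add hg.periodic, ?_⟩
    rw [weightedCoeff_add σ hf.continuous hg.continuous]
    exact hf.memℓp.add hg.memℓp
  smul_mem' := by
    intro a f hf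
    have e : (fun x => (((a • f) x : ℝ) : ℂ)) = fun x => (a : ℂ) * (f x : ℂ) := by
      ext x; simp
    show MemSobolev σ _
    rw [e]
    refine ⟨continuous_const.mul hf.continuous, fun x => by simp [hf.periodic x], ?_⟩
    rw [weightedCoeff_smul]
    exact hf.memℓp.const_smul (a : ℂ)

/-- The Sobolev space `H^σ(S¹; ℝ)`, with the norm `(∑ₙ (1 + n²)^σ |f̂(n)|²)^{1/2}`
(see the instances below). -/
def H (σ : ℝ) : Type := sobolevSubmodule σ

namespace H

instance (σ : ℝ) : AddCommGroup (H σ) := inferInstanceAs (AddCommGroup (sobolevSubmodule σ))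

instance (σ : ℝ) : Module ℝ (H σ) := inferInstanceAs (Module ℝ (sobolevSubmodule σ))

instance (σ : ℝ) : CoeFun (H σ) (fun _ => ℝ → ℝ) := ⟨fun f => f.1⟩

/-- The isometric embedding of `H^σ(S¹; ℝ)` into `ℓ²`. -/
def toℓ (σ : ℝ) : H σ →ₗ[ℝ] lp (fun _ : ℤ => ℂ) 2 where
  toFun f := ⟨weightedCoeff σ fun x => (f x : ℂ), f.2.memℓp⟩
  map_add' f g := by
    apply Subtype.ext
    have e : (fun x => (((f + g : H σ) x : ℝ) : ℂ)) = fun x => (f x : ℂ) + (g x : ℂ) := by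
      ext x
      exact Complex.ofReal_add _ _
    show weightedCoeff σ _ = weightedCoeff σ _ + weightedCoeff σ _
    rw [e, weightedCoeff_add σ f.2.continuous g.2.continuous]
  map_smul' a f := by
    apply Subtype.ext
    have e : (fun x => (((a • f : H σ) x : ℝ) : ℂ)) = fun x => (a : ℂ) * (f x : ℂ) := by
      ext x
      exact Complex.ofReal_mul _ _
    show weightedCoeff σ _ = a • weightedCoeff σ _
    rw [e, weightedCoeff_smul]
    ext n
    simp

theorem toℓ_injective (σ : ℝ) : Function.Injective (toℓ σ) := by
  rw [injective_iff_map_eq_zero]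
  intro f hf
  have h0 : weightedCoeff σ (fun x => (f x : ℂ)) = 0 := congrArg Subtype.val hf
  have h1 : ∀ n, coeff (fun x => (f x : ℂ)) n = 0 := by
    intro n
    have hn := congrFun h0 n
    simp only [weightedCoeff, Pi.zero_apply, mul_eq_zero, Complex.ofReal_eq_zero] at hn
    exact hn.resolve_left (Real.rpow_pos_of_pos (by positivity) _).ne'
  have h2 := eq_zero_of_coeff f.2.continuous f.2.periodic h1
  apply Subtype.ext
  funext x
  have := congrFun h2 x
  exact Complex.ofReal_eq_zero.mp this

instance (σ : ℝ) : NormedAddCommGroup (H σ) :=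
  NormedAddCommGroup.induced (H σ) _ (toℓ σ) (toℓ_injective σ)

instance (σ : ℝ) : NormedSpace ℝ (H σ) := NormedSpace.induced ℝ (H σ) _ (toℓ σ)

end H

/-- The subspace `H₀^σ(S¹; ℝ) = {u ∈ H^σ(S¹; ℝ) | u(0) = 0}`, with the norm of `H^σ(S¹; ℝ)`. -/
def H₀ (σ : ℝ) : Submodule ℝ (H σ) where
  carrier := {u | u 0 = 0}
  zero_mem' := rfl
  add_mem' := by
    intro u v hu hv
    show u 0 + v 0 = 0
    rw [show u 0 = 0 from hu, show v 0 = 0 from hv, add_zero]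
  smul_mem' := by
    intro a u hu
    show a * u 0 = 0
    rw [show u 0 = 0 from hu, mul_zero]

/-! ### The group `G^s` -/

/-- An element `(φ, α)` of `G^s = Diff₀^s(S¹) ⋉ H^{s-1}(S¹; ℝ/4πℤ)`.  Here `φ = id + h` with
`h ∈ H₀^s(S¹; ℝ)` and `h_x > -1`, and `α` is a map from the circle to `ℝ/4πℤ` of class `H^{s-1}`:
a map of winding number `k` has the form `α(x) = 4πkx + β(x) mod 4π` with
`β ∈ H^{s-1}(S¹; ℝ)`. -/
@[ext]
structure G (s : ℝ) where
  h : H₀ s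
  neg_one_lt_deriv : ∀ x : ℝ, -1 < deriv (h : H s) x
  α : ℝ → AddCircle (4 * Real.pi)
  exists_lift : ∃ (k : ℤ) (β : H (s - 1)), ∀ x : ℝ,
    α x = ((4 * Real.pi * k * x + β x : ℝ) : AddCircle (4 * Real.pi))

/-- The diffeomorphism `φ = id + h`, lifted to the real line. -/
def G.φ {s : ℝ} (p : G s) (x : ℝ) : ℝ := x + (p.h : H s) x

/-- The inverse diffeomorphism `φ⁻¹`, lifted to the real line. -/
def G.φInv {s : ℝ} (p : G s) : ℝ → ℝ := Function.invFun p.φ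

/-- The neutral element `(id, 0)`. -/
def G.one (s : ℝ) : G s where
  h := 0
  neg_one_lt_deriv := by
    intro x
    have e : ((((0 : H₀ s) : H s)) : ℝ → ℝ) = fun _ => 0 := rfl
    rw [e]
    simp
  α := 0
  exists_lift := by
    refine ⟨0, 0, fun x => ?_⟩
    have e : (((0 : H (s - 1))) : ℝ → ℝ) x = 0 := rfl
    rw [e]
    simp

/-- The tangent space `T_{(φ,α)} G^s ≃ H₀^s(S¹; ℝ) × H^{s-1}(S¹; ℝ)`. -/
abbrev TG (s : ℝ) : Type := H₀ s × H (s - 1)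

/-- A tangent vector as a pair of functions. -/
def TG.fn {s : ℝ} (U : TG s) : (ℝ → ℝ) × (ℝ → ℝ) := ((U.1 : H s), U.2)

/-- Right translation `U ↦ (U₁ ∘ φ⁻¹, U₂ ∘ φ⁻¹)` of a tangent vector at `(φ, α)` to the
identity. -/
def G.toId {s : ℝ} (p : G s) (U : TG s) : (ℝ → ℝ) × (ℝ → ℝ) :=
  (U.fn.1 ∘ p.φInv, U.fn.2 ∘ p.φInv)

/-- The metric at the identity: `¼ ∫ (u₁ₓ v₁ₓ + u₂ v₂) dx`. -/
def metricId (u v : (ℝ → ℝ) × (ℝ → ℝ)) : ℝ :=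
  (1 / 4) * ∫ x in (0 : ℝ)..1, (deriv u.1 x * deriv v.1 x + u.2 x * v.2 x)

/-- The right-invariant metric on `G^s`. -/
def metric {s : ℝ} (p : G s) (U V : TG s) : ℝ := metricId (p.toId U) (p.toId V)

/-- The inverse `A⁻¹` of `A = -∂ₓ²`, defined on mean-zero functions. -/
def AInv (f : ℝ → ℝ) (x : ℝ) : ℝ :=
  -(∫ y in (0 : ℝ)..x, ∫ z in (0 : ℝ)..y, f z) +
    x * ∫ y in (0 : ℝ)..1, ∫ z in (0 : ℝ)..y, f z

/-- The Christoffel map of the metric at the identity: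
`Γ(u, v) = -½ (A⁻¹ ∂ₓ(u₁ₓ v₁ₓ + u₂ v₂), u₁ₓ v₂ + v₁ₓ u₂)`. -/
def christoffelId (u v : (ℝ → ℝ) × (ℝ → ℝ)) : (ℝ → ℝ) × (ℝ → ℝ) :=
  (fun x => -(1 / 2) * AInv (deriv fun y => deriv u.1 y * deriv v.1 y + u.2 y * v.2 y) x,
   fun x => -(1 / 2) * (deriv u.1 x * v.2 x + deriv v.1 x * u.2 x))

/-- The Christoffel map at `(φ, α)`, extended from the identity by right invariance:
`Γ_{(φ,α)}(u ∘ φ, v ∘ φ) = Γ_{(id,0)}(u, v) ∘ φ`. -/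
def christoffel {s : ℝ} (p : G s) (U V : TG s) : (ℝ → ℝ) × (ℝ → ℝ) :=
  ((christoffelId (p.toId U) (p.toId V)).1 ∘ p.φ, (christoffelId (p.toId U) (p.toId V)).2 ∘ p.φ)

/-! ### Geodesics -/

/-- The time interval `[0, T)`, where `T = ∞` is allowed. -/
def timeInterval (T : ℝ≥0∞) : Set ℝ := {t | 0 ≤ t ∧ ENNReal.ofReal t < T}

/-- The curve `γ` in the Banach manifold `G^s` has velocity `v` at time `t` (relative to the time
set `J`): derivative in the chart `(h, β) ↦ (id + h, α(t) + β mod 4π)` around `γ(t)`. -/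
structure HasVelocityWithinAt {s : ℝ} (γ : ℝ → G s) (v : TG s) (J : Set ℝ) (t : ℝ) : Prop where
  fst : HasDerivWithinAt (fun τ => (γ τ).h) v.1 J t
  snd : ∃ β : ℝ → H (s - 1), β t = 0 ∧
    (∀ᶠ τ in 𝓝[J] t, ∀ x : ℝ,
      (γ τ).α x = (γ t).α x + ((β τ x : ℝ) : AddCircle (4 * Real.pi))) ∧
    HasDerivWithinAt β v.2 J t

/-- `γ : [0, T) → G^s` is a smooth geodesic with velocity field `γ' = (φ_t, α_t)`:
it solves `(φ_tt, α_tt) = Γ_{(φ,α)}((φ_t, α_t), (φ_t, α_t))`. In the charts used above the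
transition maps are translations, so `γ` is smooth if and only if its velocity is. -/
structure IsGeodesic (s : ℝ) (T : ℝ≥0∞) (γ : ℝ → G s) (γ' : ℝ → TG s) : Prop where
  pos : 0 < T
  velocity : ∀ t ∈ timeInterval T, HasVelocityWithinAt γ (γ' t) (timeInterval T) t
  smooth : ContDiffOn ℝ ∞ γ' (timeInterval T)
  equation : ∀ t ∈ timeInterval T,
    TG.fn (derivWithin γ' (timeInterval T) t) = christoffel (γ t) (γ' t) (γ' t)

/-- `γ` is the geodesic in `G^s` with `γ(0) = (id, 0)` and `γ_t(0) = (u₀, ρ₀)`, and `T` is its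
maximal existence time: it does not extend to a geodesic on a longer interval. -/
structure IsMaximalGeodesicFrom (s : ℝ) (u₀ ρ₀ : ℝ → ℝ) (T : ℝ≥0∞) (γ : ℝ → G s)
    (γ' : ℝ → TG s) : Prop where
  isGeodesic : IsGeodesic s T γ γ'
  position_zero : γ 0 = G.one s
  velocity_zero : (γ' 0).fn = (u₀, ρ₀)
  maximal : ∀ (T' : ℝ≥0∞) (δ : ℝ → G s) (δ' : ℝ → TG s),
    IsGeodesic s T' δ δ' → EqOn δ γ (timeInterval T) → T' ≤ T

/-! ### The map `Φ` to the sphere -/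

/-- `Φ(φ, α) = √φₓ e^{iα/2}`; on `ℝ/4πℤ`, `AddCircle.toCircle` is the map `α ↦ e^{iα/2}`. -/
def Phi {s : ℝ} (p : G s) (x : ℝ) : ℂ :=
  (Real.sqrt (deriv p.φ x) : ℂ) * (AddCircle.toCircle (p.α x) : ℂ)

/-- The set `𝒰^σ` of nowhere vanishing functions of class `H^σ` in the unit sphere of
`L²(S¹; ℂ)`. -/
def sphereU (σ : ℝ) : Set (ℝ → ℂ) :=
  {f | MemSobolev σ f ∧ (∫ x in (0 : ℝ)..1, ‖f x‖ ^ 2) = 1 ∧ ∀ x, f x ≠ 0}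

/-- The great circle `cos ct + (u₀ₓ + iρ₀)/(2c) sin ct`. -/
def greatCircle (c : ℝ) (u₀ ρ₀ : ℝ → ℝ) (t x : ℝ) : ℂ :=
  Real.cos (c * t) + (((deriv u₀ x : ℝ) : ℂ) + Complex.I * (ρ₀ x : ℂ)) / (2 * c) * Real.sin (c * t)

end

end HunterSaxton

/-!
Everything rests on the fact that `H^σ(S¹; ℂ)`, `σ > 1/2`, is a commutative Banach algebra in which
a nowhere vanishing function is invertible (`S.isUnit_of_ne_zero`). The first part is Young's
inequality on the Fourier side. The second is Gelfand theory: the powers of `e^{2πix}` have norms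
of polynomial growth, so every character of the algebra is an evaluation at a point. With
`σ = s - 1` the quantities `φₓ`, `φ_tx`, `α_t` of a geodesic become smooth curves in this algebra,
and no ordinary differential equation with a nonlinear right-hand side has to be solved.

In Lagrangian variables (`G.christoffel_eq`) the geodesic equation reads
`φ_ttx = ½ K - ½ (∫ K) φₓ` and `φₓ α_tt = -φ_tx α_t`, where `K = φ_tx²/φₓ + α_t² φₓ` is the energy
density. Hence `φₓ α_t = ρ₀` is conserved, `K_t = -(∫ K) φ_tx`, and the energy `¼ ∫ K = c²` is
conserved because `φ_tx` has mean zero. Then `K + 4c² φₓ` is conserved as well, and `φₓ` solves the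
linear oscillator equation `J_tt = ½ (u₀ₓ² + ρ₀² + 4c²) - 4c² J`, whose solution is `|f|²` with the
great circle `f = cos ct + (u₀ₓ + iρ₀)/(2c) sin ct` (`IsGeodesic.jac_eq`). Both `√φₓ e^{iα/2}` and
`f` solve the same linear equation in `t`, so they agree (`IsGeodesic.Phi_eq`), and `Φ` is
injective. In particular a geodesic cannot outlive the first zero of `f` (`IsGeodesic.le_maxTime`).

Conversely, up to the first zero of `f` the formulas
`φ = id + sin² ct · w + (sin ct cos ct / c) u₀`, `w = ∫₀ˣ ((u₀ₓ² + ρ₀²)/(4c²) - 1)`, and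
`α = ∫₀ᵗ ρ₀/φₓ` define a geodesic (`isGeodesic_geo`), the last one because of the invertibility
of `φₓ` in `H^{s-1}`. So the existence time is the time `maxTime` of the first zero of `f`, which
depends neither on `s` nor on the geodesic, and which is infinite exactly if `ρ₀` has no zero.
-/

namespace HunterSaxton

noncomputable section

/-! ### Sobolev weights and convolution on `ℤ` -/

/-- The Sobolev weight `(1 + n²)^{σ/2}`. -/
def weight (σ : ℝ) (n : ℤ) : ℝ := (1 + (n : ℝ) ^ 2) ^ (σ / 2)

theorem weight_pos (σ : ℝ) (n : ℤ) : 0 < weight σ n :=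
  Real.rpow_pos_of_pos (by positivity) _

theorem weightedCoeff_eq (σ : ℝ) (f : ℝ → ℂ) (n : ℤ) :
    weightedCoeff σ f n = (weight σ n : ℂ) * coeff f n := rfl

theorem norm_weightedCoeff (σ : ℝ) (f : ℝ → ℂ) (n : ℤ) :
    ‖weightedCoeff σ f n‖ = weight σ n * ‖coeff f n‖ := by
  rw [weightedCoeff_eq, norm_mul, Complex.norm_real, Real.norm_of_nonneg (weight_pos σ n).le]

theorem weight_mono {σ τ : ℝ} (h : σ ≤ τ) (n : ℤ) : weight σ n ≤ weight τ n :=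
  Real.rpow_le_rpow_of_exponent_le (by nlinarith [sq_nonneg (n : ℝ)]) (by linarith)

/-- The weight is subadditive up to a constant; this is what makes `H^σ` an algebra. -/
theorem weight_le {σ : ℝ} (hσ : 0 ≤ σ) (n k : ℤ) :
    weight σ n ≤ 4 ^ (σ / 2) * (weight σ k + weight σ (n - k)) := by
  have key : ∀ a b : ℤ, 1 + (a : ℝ) ^ 2 ≤ 1 + (b : ℝ) ^ 2 → n = a + b →
      weight σ n ≤ 4 ^ (σ / 2) * weight σ b := by
    intro a b hab hn
    unfold weight
    rw [← Real.mul_rpow (by norm_num) (by positivity)]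
    apply Real.rpow_le_rpow (by positivity) _ (by linarith)
    rw [hn]
    push_cast
    nlinarith [sq_nonneg ((a : ℝ) - b)]
  have h1 := (weight_pos σ k).le
  have h2 := (weight_pos σ (n - k)).le
  have h4 : (0 : ℝ) ≤ 4 ^ (σ / 2) := by positivity
  rcases le_total (1 + ((k : ℤ) : ℝ) ^ 2) (1 + (((n - k : ℤ)) : ℝ) ^ 2) with h | h
  · refine (key k (n - k) h (by ring)).trans ?_
    gcongr; linarith
  · refine (key (n - k) k h (by ring)).trans ?_
    gcongr; linarith

theorem memℓp_inv_weight {σ : ℝ} (hσ : 1 / 2 < σ) :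
    Memℓp (fun n => (((weight σ n)⁻¹ : ℝ) : ℂ)) 2 := by
  rw [memℓp_gen_iff (by norm_num)]
  have h := Real.summable_abs_int_rpow (b := 2 * σ) (by linarith)
  refine Summable.of_norm_bounded_eventually h ?_
  rw [Filter.eventually_cofinite]
  refine (Set.finite_singleton (0 : ℤ)).subset fun n hn => ?_
  by_contra hn0
  apply hn
  have hn1 : (0 : ℝ) < |(n : ℝ)| := abs_pos.mpr (by exact_mod_cast hn0)
  have e : (2 : ℝ≥0∞).toReal = 2 := by norm_num
  rw [e, Complex.norm_real, Real.norm_of_nonneg (by positivity),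
    Real.norm_of_nonneg (inv_nonneg.mpr (weight_pos _ _).le), weight,
    ← Real.rpow_neg (by positivity), ← Real.rpow_mul (by positivity)]
  have e1 : -(σ / 2) * 2 = -σ := by ring
  have e2 : |(n : ℝ)| ^ (-(2 * σ)) = ((n : ℝ) ^ 2) ^ (-σ) := by
    rw [← sq_abs, ← Real.rpow_natCast, ← Real.rpow_mul hn1.le]
    norm_num
  rw [e1, e2]
  apply Real.rpow_le_rpow_of_nonpos (by rw [← sq_abs]; positivity) (by linarith) (by linarith)

/-- The `ℓ²` norm of the inverse weights, the constant of the Sobolev embedding. -/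
def embConst (σ : ℝ) : ℝ := if h : 1 / 2 < σ then
  ‖(⟨_, memℓp_inv_weight h⟩ : lp (fun _ : ℤ => ℂ) 2)‖ else 0

/-- Cauchy-Schwarz: `∑ |aₙ| / wₙ ≤ C ‖a‖`. -/
theorem summable_inv_weight_mul {σ : ℝ} (hσ : 1 / 2 < σ) (a : lp (fun _ : ℤ => ℂ) 2) :
    (Summable fun n => (weight σ n)⁻¹ * ‖a n‖) ∧
      ∑' n, (weight σ n)⁻¹ * ‖a n‖ ≤ embConst σ * ‖a‖ := by
  have h := lp.tsum_mul_le_mul_norm (p := 2) (q := 2)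
    (by norm_num; exact Real.HolderConjugate.two_two)
    (⟨_, memℓp_inv_weight hσ⟩ : lp (fun _ : ℤ => ℂ) 2) a
  have e : ∀ n : ℤ, ‖(⟨_, memℓp_inv_weight hσ⟩ : lp (fun _ : ℤ => ℂ) 2) n‖ = (weight σ n)⁻¹ :=
    fun n => (Complex.norm_real _).trans
      (Real.norm_of_nonneg (inv_nonneg.mpr (weight_pos σ n).le))
  simp only [e] at h
  rw [embConst, dif_pos hσ]
  exact h

theorem memℓp_comp_sub (k : ℤ) {a : ℤ → ℝ} (ha : Memℓp a 2) : Memℓp (fun n => a (n - k)) 2 := by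
  rw [memℓp_gen_iff (by norm_num)] at ha ⊢
  exact ((Equiv.subRight k).summable_iff (f := fun n => ‖a n‖ ^ (2 : ℝ≥0∞).toReal)).mpr ha

/-- Translation by `k` on `ℓ²(ℤ)`. -/
def shift (k : ℤ) (a : lp (fun _ : ℤ => ℝ) 2) : lp (fun _ : ℤ => ℝ) 2 :=
  ⟨fun n => (a : ℤ → ℝ) (n - k), memℓp_comp_sub k (lp.memℓp a)⟩

theorem shift_apply (k : ℤ) (a : lp (fun _ : ℤ => ℝ) 2) (n : ℤ) : shift k a n = a (n - k) := rfl

theorem norm_shift (k : ℤ) (a : lp (fun _ : ℤ => ℝ) 2) : ‖shift k a‖ = ‖a‖ := by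
  rw [lp.norm_eq_tsum_rpow (by norm_num), lp.norm_eq_tsum_rpow (by norm_num)]
  simp only [shift_apply]
  rw [← (Equiv.subRight k).tsum_eq fun n => ‖a n‖ ^ (2 : ℝ≥0∞).toReal]
  simp only [Equiv.subRight_apply]

/-- Young's inequality `‖b ∗ a‖_{ℓ²} ≤ ‖b‖_{ℓ¹} ‖a‖_{ℓ²}`: the convolution is the sum of the
translates of `a` with coefficients `b`. -/
theorem exists_convolution (b : ℤ → ℝ) (hb : Summable fun k => |b k|)
    (a : lp (fun _ : ℤ => ℝ) 2) :
    ∃ c : lp (fun _ : ℤ => ℝ) 2, (∀ n, HasSum (fun k => b k * a (n - k)) (c n)) ∧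
      ‖c‖ ≤ (∑' k, |b k|) * ‖a‖ := by
  have hn : ∀ k, ‖b k • shift k a‖ = |b k| * ‖a‖ := fun k => by
    rw [norm_smul, norm_shift, Real.norm_eq_abs]
  have hs : Summable fun k => ‖b k • shift k a‖ := by
    simp only [hn]; exact hb.mul_right _
  refine ⟨∑' k, b k • shift k a, fun n => ?_, ?_⟩
  · exact (lp.evalCLM ℝ (fun _ : ℤ => ℝ) 2 n).hasSum hs.of_norm.hasSum
  · refine (norm_tsum_le_tsum_norm hs).trans ?_
    simp only [hn]
    rw [tsum_mul_right]

/-! ### Fourier series of functions of class `H^σ`, `σ > 1/2` -/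

/-- The character `x ↦ e^{2πinx}` on the real line. -/
def character (n : ℤ) (x : ℝ) : ℂ := fourier n (x : UnitAddCircle)

theorem continuous_character (n : ℤ) : Continuous (character n) :=
  (map_continuous (fourier (T := 1) n)).comp (AddCircle.continuous_mk' 1)

theorem periodic_character (n : ℤ) : Function.Periodic (character n) 1 := fun x => by
  simp [character]

theorem norm_character (n : ℤ) (x : ℝ) : ‖character n x‖ = 1 := by
  rw [character, fourier_apply, Circle.norm_coe]

theorem character_add (m n : ℤ) (x : ℝ) : character (m + n) x = character m x * character n x :=
  fourier_add

theorem character_zero (x : ℝ) : character 0 x = 1 := fourier_zero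

theorem coeff_def (f : ℝ → ℂ) (n : ℤ) :
    coeff f n = ∫ x in (0 : ℝ)..1, character (-n) x * f x := rfl

theorem coeff_one (n : ℤ) : coeff (fun _ => 1) n = if n = 0 then 1 else 0 := by
  have h := congrFun (fourierCoeff_fourier (T := 1) 0) n
  rw [fourierCoeff_eq_intervalIntegral _ n 0] at h
  simp only [zero_add, div_one, one_smul] at h
  simpa [coeff, Pi.single_apply] using h

/-- The Fourier coefficients of a product are the convolution of the Fourier coefficients. -/
theorem hasSum_coeff_mul {a : ℤ → ℂ} (ha : Summable fun n => ‖a n‖) {F g : ℝ → ℂ}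
    (hF : ∀ x, HasSum (fun n => a n * character n x) (F x)) (hg : Continuous g) (n : ℤ) :
    HasSum (fun k => a k * coeff g (n - k)) (coeff (fun x => F x * g x) n) := by
  obtain ⟨M, hM⟩ := isCompact_Icc.exists_bound_of_continuousOn (s := Icc (0 : ℝ) 1) hg.continuousOn
  have key := intervalIntegral.hasSum_integral_of_dominated_convergence (μ := volume)
    (a := (0 : ℝ)) (b := 1)
    (F := fun k x => character (-n) x * ((a k * character k x) * g x))
    (f := fun x => character (-n) x * (F x * g x)) (fun k _ => ‖a k‖ * M)
    (fun k => ((continuous_character _).mul ((continuous_const.mul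
      (continuous_character _)).mul hg)).aestronglyMeasurable)
    (fun k => ae_of_all _ fun x hx => by
      rw [uIoc_of_le zero_le_one] at hx
      simp only [norm_mul, norm_character, one_mul, mul_one]
      gcongr
      exact hM x ⟨hx.1.le, hx.2⟩)
    (ae_of_all _ fun x _ => ha.mul_right M)
    intervalIntegrable_const
    (ae_of_all _ fun x _ => ((hF x).mul_right _).mul_left _)
  have e : ∀ k, a k * coeff g (n - k) =
      ∫ x in (0 : ℝ)..1, character (-n) x * ((a k * character k x) * g x) := fun k => by
    rw [coeff_def, ← intervalIntegral.integral_const_mul]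
    congr 1
    ext x
    rw [show -(n - k) = -n + k by ring, character_add]
    ring
  simp only [e]
  exact key

theorem summable_norm_of_weight {σ : ℝ} (hσ : 1 / 2 < σ) {a : ℤ → ℂ}
    (ha : Memℓp (fun n => (weight σ n : ℂ) * a n) 2) :
    (Summable fun n => ‖a n‖) ∧
      ∑' n, ‖a n‖ ≤ embConst σ * ‖(⟨_, ha⟩ : lp (fun _ : ℤ => ℂ) 2)‖ := by
  have h := summable_inv_weight_mul hσ ⟨_, ha⟩
  have e : ∀ n : ℤ, (weight σ n)⁻¹ * ‖(weight σ n : ℂ) * a n‖ = ‖a n‖ := fun n => by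
    rw [norm_mul, Complex.norm_real, Real.norm_of_nonneg (weight_pos σ n).le,
      inv_mul_cancel_left₀ (weight_pos σ n).ne']
  simp only [e] at h
  exact h

/-- The weighted Fourier coefficients as an element of `ℓ²`. -/
def MemSobolev.toLp {σ : ℝ} {f : ℝ → ℂ} (hf : MemSobolev σ f) : lp (fun _ : ℤ => ℂ) 2 :=
  ⟨weightedCoeff σ f, hf.memℓp⟩

theorem MemSobolev.summable_coeff {σ : ℝ} (hσ : 1 / 2 < σ) {f : ℝ → ℂ} (hf : MemSobolev σ f) :
    (Summable fun n => ‖coeff f n‖) ∧ ∑' n, ‖coeff f n‖ ≤ embConst σ * ‖hf.toLp‖ :=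
  summable_norm_of_weight hσ hf.memℓp

/-- A function of class `H^σ`, `σ > 1/2`, is the sum of its Fourier series. -/
theorem MemSobolev.hasSum {σ : ℝ} (hσ : 1 / 2 < σ) {f : ℝ → ℂ} (hf : MemSobolev σ f) (x : ℝ) :
    HasSum (fun n => coeff f n * character n x) (f x) := by
  let F : C(UnitAddCircle, ℂ) := ⟨hf.periodic.lift, continuous_coinduced_dom.mpr hf.continuous⟩
  have hF : ∀ x : ℝ, F (x : UnitAddCircle) = f x := fun x => hf.periodic.lift_coe x
  have hc : fourierCoeff (F : UnitAddCircle → ℂ) = coeff f := by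
    ext n
    rw [fourierCoeff_eq_intervalIntegral _ n 0]
    simp [coeff, hF]
  have hs := has_pointwise_sum_fourier_series_of_summable (f := F)
    (by rw [hc]; exact (hf.summable_coeff hσ).1.of_norm) (x : UnitAddCircle)
  rw [hc, hF] at hs
  exact hs

/-- Sobolev embedding into the bounded functions. -/
theorem MemSobolev.norm_apply_le {σ : ℝ} (hσ : 1 / 2 < σ) {f : ℝ → ℂ} (hf : MemSobolev σ f)
    (x : ℝ) : ‖f x‖ ≤ embConst σ * ‖hf.toLp‖ := by
  have h := hf.summable_coeff hσ
  have h1 : ∀ n, ‖coeff f n * character n x‖ = ‖coeff f n‖ := fun n => by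
    rw [norm_mul, norm_character, mul_one]
  rw [← (hf.hasSum hσ x).tsum_eq]
  refine (norm_tsum_le_tsum_norm (by simpa only [h1] using h.1)).trans ?_
  simpa only [h1] using h.2

/-- Every sequence of coefficients with finite `H^σ` norm is attained. -/
theorem exists_memSobolev {σ : ℝ} (hσ : 1 / 2 < σ) {a : ℤ → ℂ}
    (ha : Memℓp (fun n => (weight σ n : ℂ) * a n) 2) :
    ∃ f : ℝ → ℂ, MemSobolev σ f ∧ coeff f = a := by
  have hs := (summable_norm_of_weight hσ ha).1
  have h1 : ∀ n x, ‖a n * character n x‖ = ‖a n‖ := fun n x => by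
    rw [norm_mul, norm_character, mul_one]
  have hsum : ∀ x, HasSum (fun n => a n * character n x) (∑' n, a n * character n x) := fun x =>
    Summable.hasSum (Summable.of_norm (by simpa only [h1] using hs))
  have hc : coeff (fun x => ∑' n, a n * character n x) = a := by
    ext n
    have h2 := hasSum_coeff_mul hs hsum (g := fun _ => 1) continuous_const n
    simp only [mul_one, coeff_one] at h2
    refine h2.unique ?_
    convert hasSum_ite_eq n (a n) using 2 with k
    by_cases hk : k = n
    · simp [hk]
    · simp [hk, sub_eq_zero, Ne.symm hk]
  refine ⟨fun x => ∑' n, a n * character n x, ⟨?_, fun x => ?_, ?_⟩, hc⟩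
  · exact continuous_tsum (fun n => continuous_const.mul (continuous_character n)) hs
      fun n x => (h1 n x).le
  · simp only [periodic_character _ x]
  · have e : weightedCoeff σ (fun x => ∑' n, a n * character n x) =
        fun n => (weight σ n : ℂ) * a n := by
      ext n; rw [weightedCoeff_eq, hc]
    rw [e]; exact ha

theorem MemSobolev.mono {σ τ : ℝ} (h : τ ≤ σ) {f : ℝ → ℂ} (hf : MemSobolev σ f) :
    MemSobolev τ f :=
  ⟨hf.continuous, hf.periodic, hf.memℓp.mono' fun n => by
    rw [norm_weightedCoeff, norm_weightedCoeff]
    gcongr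
    exact weight_mono h n⟩

/-- `H^σ` is closed under products for `σ > 1/2`, with a norm estimate. -/
theorem MemSobolev.mul {σ : ℝ} (hσ : 1 / 2 < σ) {f g : ℝ → ℂ} (hf : MemSobolev σ f)
    (hg : MemSobolev σ g) :
    ∃ h : MemSobolev σ fun x => f x * g x,
      ‖h.toLp‖ ≤ 4 ^ (σ / 2) * (2 * embConst σ) * (‖hf.toLp‖ * ‖hg.toLp‖) := by
  -- `A` and `B` are the moduli of the weighted coefficients; the weighted coefficients of the
  -- product are dominated by `4^{σ/2} (|f̂| ∗ B + |ĝ| ∗ A)`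
  let A : lp (fun _ : ℤ => ℝ) 2 := ⟨fun n => ‖weightedCoeff σ f n‖, hf.memℓp.norm⟩
  let B : lp (fun _ : ℤ => ℝ) 2 := ⟨fun n => ‖weightedCoeff σ g n‖, hg.memℓp.norm⟩
  have hA : ‖A‖ ≤ ‖hf.toLp‖ := lp.norm_mono (by norm_num) fun n => (norm_norm _).le
  have hB : ‖B‖ ≤ ‖hg.toLp‖ := lp.norm_mono (by norm_num) fun n => (norm_norm _).le
  obtain ⟨sf, nf⟩ := hf.summable_coeff hσ
  obtain ⟨sg, ng⟩ := hg.summable_coeff hσ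
  obtain ⟨u, hu, nu⟩ := exists_convolution (fun k => ‖coeff f k‖) (by simpa using sf) B
  obtain ⟨v, hv, nv⟩ := exists_convolution (fun k => ‖coeff g k‖) (by simpa using sg) A
  simp only [abs_norm] at nu nv
  have hbound : ∀ n, ‖weightedCoeff σ (fun x => f x * g x) n‖ ≤ 4 ^ (σ / 2) * (u n + v n) := by
    intro n
    have h1 := hasSum_coeff_mul sf (hf.hasSum hσ) hg.continuous n
    have hv' : HasSum (fun k => ‖coeff g (n - k)‖ * A k) (v n) := by
      rw [← (Equiv.subLeft n).hasSum_iff]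
      convert hv n using 2 with k
      simp
    have h2 := ((hu n).add hv').mul_left (4 ^ (σ / 2))
    rw [weightedCoeff_eq]
    rw [← (h1.mul_left (weight σ n : ℂ)).tsum_eq]
    refine tsum_of_norm_bounded h2 fun k => ?_
    have hw := weight_le (by linarith : 0 ≤ σ) n k
    show _ ≤ 4 ^ (σ / 2) * (‖coeff f k‖ * ‖weightedCoeff σ g (n - k)‖ +
      ‖coeff g (n - k)‖ * ‖weightedCoeff σ f k‖)
    rw [norm_mul, norm_mul, Complex.norm_real, Real.norm_of_nonneg (weight_pos σ n).le,
      norm_weightedCoeff, norm_weightedCoeff]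
    calc _ ≤ 4 ^ (σ / 2) * (weight σ k + weight σ (n - k)) *
          (‖coeff f k‖ * ‖coeff g (n - k)‖) := by gcongr
      _ = _ := by ring
  let K : lp (fun _ : ℤ => ℝ) 2 := (4 ^ (σ / 2) : ℝ) • (u + v)
  have hK : ∀ n, ‖weightedCoeff σ (fun x => f x * g x) n‖ ≤ ‖K n‖ := fun n =>
    (hbound n).trans (Real.le_norm_self _)
  have hm : MemSobolev σ fun x => f x * g x :=
    ⟨hf.continuous.mul hg.continuous, hf.periodic.mul hg.periodic, (lp.memℓp K).mono' hK⟩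
  refine ⟨hm, ?_⟩
  have hKn : ‖hm.toLp‖ ≤ ‖K‖ := lp.norm_mono (by norm_num) hK
  refine hKn.trans ?_
  have h4 : (0 : ℝ) ≤ 4 ^ (σ / 2) := by positivity
  have pf := (tsum_nonneg fun n => norm_nonneg (coeff f n)).trans nf
  have pg := (tsum_nonneg fun n => norm_nonneg (coeff g n)).trans ng
  have bu : ‖u‖ ≤ embConst σ * ‖hf.toLp‖ * ‖hg.toLp‖ :=
    nu.trans (mul_le_mul nf hB (norm_nonneg _) pf)
  have bv : ‖v‖ ≤ embConst σ * ‖hg.toLp‖ * ‖hf.toLp‖ :=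
    nv.trans (mul_le_mul ng hA (norm_nonneg _) pg)
  calc ‖K‖ ≤ 4 ^ (σ / 2) * (‖u‖ + ‖v‖) := by
        rw [show K = (4 ^ (σ / 2) : ℝ) • (u + v) from rfl, norm_smul, Real.norm_of_nonneg h4]
        gcongr
        exact norm_add_le _ _
    _ ≤ 4 ^ (σ / 2) * (embConst σ * ‖hf.toLp‖ * ‖hg.toLp‖ +
          embConst σ * ‖hg.toLp‖ * ‖hf.toLp‖) := by
        exact mul_le_mul_of_nonneg_left (add_le_add bu bv) h4
    _ = _ := by ring

theorem coeff_character (m n : ℤ) : coeff (character m) n = if n = m then 1 else 0 := by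
  have e : coeff (character m) n = coeff (fun _ => 1) (n - m) := by
    rw [coeff_def, coeff_def]
    congr 1
    ext x
    rw [show -(n - m) = -n + m by ring, character_add, mul_one]
  rw [e, coeff_one]
  simp only [sub_eq_zero]

theorem weightedCoeff_character (σ : ℝ) (m : ℤ) :
    weightedCoeff σ (character m) = Pi.single m (weight σ m : ℂ) := by
  ext n
  rw [weightedCoeff_eq, coeff_character]
  by_cases h : n = m
  · subst h; simp
  · simp [h]

theorem memSobolev_character (σ : ℝ) (m : ℤ) : MemSobolev σ (character m) :=
  ⟨continuous_character m, periodic_character m, by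
    refine (memℓp_zero ((Set.finite_singleton m).subset fun n hn => ?_)).of_exponent_ge zero_le
    by_contra h
    rw [Set.mem_singleton_iff] at h
    exact hn (by rw [weightedCoeff_character, Pi.single_eq_of_ne h])⟩

theorem memSobolev_const (σ : ℝ) (a : ℂ) : MemSobolev σ fun _ => a := by
  refine ⟨continuous_const, fun x => rfl, ?_⟩
  have e : weightedCoeff σ (fun _ => a) = a • weightedCoeff σ (character 0) := by
    rw [← weightedCoeff_smul]
    simp only [character_zero, mul_one]
  rw [e]
  exact (memSobolev_character σ 0).memℓp.const_smul a

/-! ### The Banach algebra `H^σ(S¹; ℂ)`, `σ > 1/2` -/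

theorem embConst_nonneg (σ : ℝ) : 0 ≤ embConst σ := by
  unfold embConst; split_ifs
  · exact norm_nonneg _
  · exact le_rfl

/-- The factor that makes the Fourier norm submultiplicative. -/
def normConst (σ : ℝ) : ℝ := 4 ^ (σ / 2) * (2 * embConst σ) + 1

theorem normConst_pos {σ : ℝ} : 0 < normConst σ := by
  have := embConst_nonneg σ
  unfold normConst
  positivity

/-- `H^σ(S¹; ℂ)`, `σ > 1/2`, as an algebra of periodic functions. -/
def sobolevSubalgebra (σ : ℝ) [hσ : Fact (1 / 2 < σ)] : Subalgebra ℂ (ℝ → ℂ) where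
  carrier := {f | MemSobolev σ f}
  mul_mem' hf hg := (hf.mul hσ.out hg).1
  add_mem' {f g} hf hg := by
    refine ⟨hf.continuous.add hg.continuous, hf.periodic.add hg.periodic, ?_⟩
    have e := weightedCoeff_add σ hf.continuous hg.continuous
    rw [show f + g = fun x => f x + g x from rfl, e]
    exact hf.memℓp.add hg.memℓp
  algebraMap_mem' a := memSobolev_const σ a

/-- The Banach algebra `H^σ(S¹; ℂ)`, `σ > 1/2`. Its norm is the Fourier norm multiplied by a
constant that makes it submultiplicative. -/
def S (σ : ℝ) [Fact (1 / 2 < σ)] : Type := sobolevSubalgebra σ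

namespace S

variable {σ : ℝ} [hσ : Fact (1 / 2 < σ)]

instance : CommRing (S σ) := inferInstanceAs (CommRing (sobolevSubalgebra σ))

instance : Algebra ℂ (S σ) := inferInstanceAs (Algebra ℂ (sobolevSubalgebra σ))

instance : CoeFun (S σ) (fun _ => ℝ → ℂ) := ⟨fun f => f.1⟩

theorem mem (f : S σ) : MemSobolev σ f := f.2

@[ext]
theorem ext {f g : S σ} (h : ∀ x, f x = g x) : f = g := Subtype.ext (funext h)

@[simp] theorem add_apply (f g : S σ) (x : ℝ) : (f + g) x = f x + g x := rfl
@[simp] theorem sub_apply (f g : S σ) (x : ℝ) : (f - g) x = f x - g x := rfl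
@[simp] theorem neg_apply (f : S σ) (x : ℝ) : (-f) x = -f x := rfl
@[simp] theorem mul_apply (f g : S σ) (x : ℝ) : (f * g) x = f x * g x := rfl
@[simp] theorem pow_apply (f : S σ) (n : ℕ) (x : ℝ) : (f ^ n) x = f x ^ n := rfl
@[simp] theorem one_apply (x : ℝ) : (1 : S σ) x = 1 := rfl
@[simp] theorem zero_apply (x : ℝ) : (0 : S σ) x = 0 := rfl
@[simp] theorem smul_apply (a : ℂ) (f : S σ) (x : ℝ) : (a • f) x = a * f x := rfl

variable (σ) in
/-- The weighted Fourier coefficients, scaled by `normConst`. -/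
def toSeq : S σ →ₗ[ℂ] lp (fun _ : ℤ => ℂ) 2 where
  toFun f := (normConst σ : ℂ) • f.mem.toLp
  map_add' f g := by
    rw [← smul_add]
    congr 1
    exact Subtype.ext (weightedCoeff_add σ f.mem.continuous g.mem.continuous)
  map_smul' a f := by
    rw [RingHom.id_apply, smul_comm]
    congr 1
    exact Subtype.ext (weightedCoeff_smul σ a f)

theorem toSeq_injective : Function.Injective (toSeq σ) := by
  rw [injective_iff_map_eq_zero]
  intro f hf
  have h0 : f.mem.toLp = 0 :=
    (smul_eq_zero.mp hf).resolve_left (Complex.ofReal_ne_zero.mpr normConst_pos.ne')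
  refine Subtype.ext (eq_zero_of_coeff f.mem.continuous f.mem.periodic fun n => ?_)
  have hn : (weight σ n : ℂ) * coeff f n = 0 := congrFun (congrArg Subtype.val h0) n
  exact (mul_eq_zero.mp hn).resolve_left (Complex.ofReal_ne_zero.mpr (weight_pos σ n).ne')

theorem toSeq_surjective : Function.Surjective (toSeq σ) := by
  intro b
  have hw : ∀ n, (weight σ n : ℂ) ≠ 0 := fun n => Complex.ofReal_ne_zero.mpr (weight_pos σ n).ne'
  have hK : (normConst σ : ℂ) ≠ 0 := Complex.ofReal_ne_zero.mpr normConst_pos.ne'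
  have e : (fun n => (weight σ n : ℂ) * ((normConst σ : ℂ)⁻¹ * ((weight σ n : ℂ)⁻¹ * b n))) =
      (normConst σ : ℂ)⁻¹ • (b : ℤ → ℂ) := by
    ext n
    rw [Pi.smul_apply, smul_eq_mul]
    field_simp [hw n]
  have hm : Memℓp (fun n => (weight σ n : ℂ) *
      ((normConst σ : ℂ)⁻¹ * ((weight σ n : ℂ)⁻¹ * b n))) 2 := by
    rw [e]; exact (lp.memℓp b).const_smul _
  obtain ⟨f, hf, hc⟩ := exists_memSobolev hσ.out hm
  refine ⟨⟨f, hf⟩, ?_⟩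
  apply lp.ext
  ext n
  show (normConst σ : ℂ) * ((weight σ n : ℂ) * coeff f n) = b n
  rw [hc]
  have := hw n
  field_simp

instance : NormedAddCommGroup (S σ) :=
  NormedAddCommGroup.induced (S σ) _ (toSeq σ) toSeq_injective

theorem norm_eq_toSeq (f : S σ) : ‖f‖ = ‖toSeq σ f‖ := rfl

theorem norm_def (f : S σ) : ‖f‖ = normConst σ * ‖f.mem.toLp‖ := by
  show ‖(normConst σ : ℂ) • f.mem.toLp‖ = _
  rw [norm_smul, Complex.norm_real, Real.norm_of_nonneg normConst_pos.le]

instance : NormedCommRing (S σ) where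
  __ := (inferInstance : CommRing (S σ))
  __ := (inferInstance : NormedAddCommGroup (S σ))
  norm_mul_le f g := by
    obtain ⟨h, hh⟩ := f.mem.mul hσ.out g.mem
    have h1 : (f * g).mem.toLp = h.toLp := rfl
    show ‖f * g‖ ≤ ‖f‖ * ‖g‖
    rw [norm_def, norm_def, norm_def, h1]
    have h2 : 4 ^ (σ / 2) * (2 * embConst σ) ≤ normConst σ := by unfold normConst; linarith
    have := normConst_pos (σ := σ)
    calc normConst σ * ‖h.toLp‖
        ≤ normConst σ * (normConst σ * (‖f.mem.toLp‖ * ‖g.mem.toLp‖)) := by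
          gcongr
          exact hh.trans (by gcongr)
      _ = _ := by ring

instance : NormedAlgebra ℂ (S σ) where
  norm_smul_le a f := by
    rw [norm_eq_toSeq, norm_eq_toSeq, map_smul, norm_smul]

theorem isometry_toSeq : Isometry (toSeq σ) :=
  AddMonoidHomClass.isometry_of_norm _ fun _ => rfl

instance : CompleteSpace (S σ) :=
  ((isometry_toSeq (σ := σ)).isUniformInducing.completeSpace_congr toSeq_surjective).mpr
    inferInstance

instance : Nontrivial (S σ) := ⟨0, 1, fun h => by
  have := congrArg (fun f : S σ => f 0) h
  simp at this⟩

@[simp] theorem real_smul_apply (a : ℝ) (f : S σ) (x : ℝ) : (a • f) x = a * f x := rfl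

theorem norm_toLp (f : S σ) : ‖f.mem.toLp‖ = (normConst σ)⁻¹ * ‖f‖ := by
  rw [norm_def, inv_mul_cancel_left₀ normConst_pos.ne']

/-- Evaluation at a point. -/
def eval (x : ℝ) : S σ →L[ℂ] ℂ :=
  LinearMap.mkContinuous
    { toFun := fun f => f x, map_add' := fun _ _ => rfl, map_smul' := fun _ _ => rfl }
    (embConst σ * (normConst σ)⁻¹) fun f => by
      rw [mul_assoc, ← norm_toLp]
      exact f.mem.norm_apply_le hσ.out x

@[simp] theorem eval_apply (x : ℝ) (f : S σ) : eval x f = f x := rfl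

/-- The mean value over the circle. -/
def mean : S σ →L[ℂ] ℂ :=
  LinearMap.mkContinuous
    { toFun := fun f => ∫ x in (0 : ℝ)..1, f x
      map_add' := fun f g => intervalIntegral.integral_add
        (f.mem.continuous.intervalIntegrable _ _) (g.mem.continuous.intervalIntegrable _ _)
      map_smul' := fun a f => intervalIntegral.integral_const_mul _ _ }
    (embConst σ * (normConst σ)⁻¹) fun f => by
      rw [mul_assoc, ← norm_toLp]
      have := intervalIntegral.norm_integral_le_of_norm_le_const (a := (0 : ℝ)) (b := 1)
        (f := f) fun x _ => f.mem.norm_apply_le hσ.out x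
      rw [sub_zero, abs_one, mul_one] at this
      exact this

theorem mean_apply (f : S σ) : mean f = ∫ x in (0 : ℝ)..1, f x := rfl

/-! ### Wiener's lemma for `H^σ` -/

/-- The character `x ↦ e^{2πinx}` as an element of `H^σ`. -/
def char (n : ℤ) : S σ := ⟨character n, memSobolev_character σ n⟩

theorem char_add (m n : ℤ) : (char (m + n) : S σ) = char m * char n :=
  ext fun x => character_add m n x

theorem char_zero : (char 0 : S σ) = 1 := ext fun x => character_zero x

theorem toSeq_char (n : ℤ) :
    toSeq σ (char n) = lp.single 2 n ((normConst σ : ℂ) * (weight σ n : ℂ)) := by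
  apply lp.ext
  ext m
  show (normConst σ : ℂ) * weightedCoeff σ (character n) m =
    (Pi.single n ((normConst σ : ℂ) * (weight σ n : ℂ)) : ℤ → ℂ) m
  rw [weightedCoeff_character]
  by_cases h : m = n
  · subst h; simp
  · simp [h]

theorem norm_char (n : ℤ) : ‖(char n : S σ)‖ = normConst σ * weight σ n := by
  rw [norm_eq_toSeq, toSeq_char, lp.norm_single (by norm_num), norm_mul, Complex.norm_real,
    Complex.norm_real, Real.norm_of_nonneg normConst_pos.le,
    Real.norm_of_nonneg (weight_pos σ n).le]

/-- The Fourier series of `f` converges to `f` in `H^σ`. -/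
theorem hasSum_coeff_smul_char (f : S σ) : HasSum (fun n => coeff f n • (char n : S σ)) f := by
  rw [← (isometry_toSeq (σ := σ)).isUniformInducing.isInducing.hasSum_iff (g := toSeq σ)]
  have h := lp.hasSum_single (p := 2) (by norm_num) (toSeq σ f)
  convert h using 2 with n
  rw [Function.comp_apply, map_smul, toSeq_char, ← lp.single_smul]
  congr 1
  show coeff f n * ((normConst σ : ℂ) * (weight σ n : ℂ)) =
    (normConst σ : ℂ) * ((weight σ n : ℂ) * coeff f n)
  ring

/-- A number whose powers grow at most polynomially has modulus at most one. -/
theorem norm_le_one_of_pow_le {z : ℂ} {C a : ℝ} (hC : 0 ≤ C)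
    (h : ∀ n : ℕ, ‖z‖ ^ n ≤ C * (1 + (n : ℝ) ^ 2) ^ a) : ‖z‖ ≤ 1 := by
  by_contra! hz
  obtain ⟨N, hN⟩ := exists_nat_ge a
  have hlim := (tendsto_pow_const_div_const_pow_of_one_lt (2 * N) hz).const_mul (C * 2 ^ N)
  rw [mul_zero] at hlim
  have hev := (hlim.eventually (gt_mem_nhds one_pos)).and (eventually_ge_atTop 1)
  obtain ⟨n, hn, hn1⟩ := hev.exists
  have hn1' : (1 : ℝ) ≤ n := by exact_mod_cast hn1
  have hzn : 0 < ‖z‖ ^ n := by positivity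
  rw [mul_div_assoc', div_lt_one hzn] at hn
  refine absurd (h n) (not_le.mpr (lt_of_le_of_lt ?_ hn))
  rw [mul_assoc, pow_mul, ← mul_pow]
  gcongr
  calc (1 + (n : ℝ) ^ 2) ^ a ≤ (1 + (n : ℝ) ^ 2) ^ (N : ℝ) :=
        Real.rpow_le_rpow_of_exponent_le (by nlinarith) hN
    _ = (1 + (n : ℝ) ^ 2) ^ N := Real.rpow_natCast _ _
    _ ≤ _ := by gcongr; nlinarith

/-- The spectral radius of `e^{±2πix}` in `H^σ` is at most one. -/
theorem norm_character_apply_char_le (χ : WeakDual.characterSpace ℂ (S σ)) (m : ℤ)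
    (hm : m = 1 ∨ m = -1) : ‖χ (char m)‖ ≤ 1 := by
  have hχ : ∃ C, 0 ≤ C ∧ ∀ f : S σ, ‖χ f‖ ≤ C * ‖f‖ :=
    ⟨‖WeakDual.toStrongDual (χ : WeakDual ℂ (S σ))‖, norm_nonneg _, fun f =>
      (WeakDual.toStrongDual (χ : WeakDual ℂ (S σ))).le_opNorm f⟩
  obtain ⟨C, hC, hχ⟩ := hχ
  refine norm_le_one_of_pow_le (C := C * normConst σ) (a := σ / 2)
    (mul_nonneg hC normConst_pos.le) fun n => ?_
  have hpow : (char m : S σ) ^ n = char (n * m) := by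
    induction n with
    | zero => simp [char_zero]
    | succ n ih => rw [pow_succ, ih, ← char_add]; congr 1; push_cast; ring
  rw [← norm_pow, ← map_pow, hpow]
  refine (hχ _).trans ?_
  rw [norm_char, weight, mul_assoc]
  rcases hm with rfl | rfl <;> simp

/-- Every character of the Banach algebra `H^σ` is the evaluation at a point. -/
theorem exists_eval (χ : WeakDual.characterSpace ℂ (S σ)) : ∃ x : ℝ, ∀ f : S σ, χ f = f x := by
  have hmul : χ (char 1) * χ (char (-1)) = 1 := by
    rw [← map_mul, ← char_add, add_neg_cancel, char_zero, map_one]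
  have h1 := norm_character_apply_char_le χ 1 (Or.inl rfl)
  have h2 := norm_character_apply_char_le χ (-1) (Or.inr rfl)
  have hn : ‖χ (char 1)‖ = 1 := by
    have := congrArg norm hmul
    rw [norm_mul, norm_one] at this
    nlinarith [norm_nonneg (χ (char 1)), norm_nonneg (χ (char (-1)))]
  obtain ⟨x, hx⟩ : ∃ x : ℝ, character 1 x = χ (char 1) := by
    have h := Complex.norm_mul_exp_arg_mul_I (χ (char 1))
    rw [hn, Complex.ofReal_one, one_mul] at h
    generalize Complex.arg (χ (char 1)) = θ at h
    refine ⟨θ / (2 * Real.pi), ?_⟩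
    rw [← h, character, fourier_coe_apply]
    congr 1
    push_cast
    have : (Real.pi : ℂ) ≠ 0 := Complex.ofReal_ne_zero.mpr Real.pi_ne_zero
    field_simp
  refine ⟨x, fun f => ?_⟩
  have hc : ∀ n : ℤ, χ (char n) = character n x := by
    have hx0 : character 1 x ≠ 0 := by
      rw [← norm_ne_zero_iff, norm_character]; exact one_ne_zero
    intro n
    induction n using Int.induction_on with
    | zero => rw [char_zero, map_one, character_zero]
    | succ n ih => rw [char_add, map_mul, ih, ← hx, character_add]
    | pred n ih =>
      apply mul_right_cancel₀ hx0
      rw [← character_add, sub_add_cancel, ← ih, hx, ← map_mul, ← char_add, sub_add_cancel]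
  have hs := (hasSum_coeff_smul_char f).map χ (map_continuous χ)
  refine hs.unique ?_
  convert f.mem.hasSum hσ.out x using 2 with n
  rw [Function.comp_apply, map_smul, hc, smul_eq_mul]

/-- Wiener's lemma: a nowhere vanishing function of class `H^σ` is invertible in `H^σ`. -/
theorem isUnit_of_ne_zero {f : S σ} (hf : ∀ x, f x ≠ 0) : IsUnit f := by
  by_contra h
  obtain ⟨χ, hχ⟩ := WeakDual.CharacterSpace.exists_apply_eq_zero h
  obtain ⟨x, hx⟩ := exists_eval χ
  exact hf x ((hx f).symm.trans hχ)

theorem inverse_apply {f : S σ} (hf : IsUnit f) (x : ℝ) : (Ring.inverse f) x = (f x)⁻¹ := by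
  have h := congrArg (fun g : S σ => g x) (Ring.mul_inverse_cancel f hf)
  exact eq_inv_of_mul_eq_one_right h

end S

/-! ### Real-valued functions inside the complex algebra -/

theorem MemSobolev.add {σ : ℝ} {f g : ℝ → ℂ} (hf : MemSobolev σ f) (hg : MemSobolev σ g) :
    MemSobolev σ fun x => f x + g x :=
  ⟨hf.continuous.add hg.continuous, hf.periodic.add hg.periodic, by
    rw [weightedCoeff_add σ hf.continuous hg.continuous]
    exact hf.memℓp.add hg.memℓp⟩

theorem MemSobolev.const_mul {σ : ℝ} {f : ℝ → ℂ} (a : ℂ) (hf : MemSobolev σ f) :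
    MemSobolev σ fun x => a * f x :=
  ⟨continuous_const.mul hf.continuous, fun x => by simp only [hf.periodic x], by
    rw [weightedCoeff_smul]
    exact hf.memℓp.const_smul a⟩

theorem coeff_conj (f : ℝ → ℂ) (n : ℤ) :
    coeff (fun x => starRingEnd ℂ (f x)) n = starRingEnd ℂ (coeff f (-n)) := by
  rw [coeff, coeff, intervalIntegral.integral_of_le zero_le_one,
    intervalIntegral.integral_of_le zero_le_one, ← integral_conj]
  congr 1
  ext x
  rw [map_mul, fourier_neg, fourier_neg, fourier_neg, Complex.conj_conj]

theorem weight_neg (σ : ℝ) (n : ℤ) : weight σ (-n) = weight σ n := by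
  simp [weight]

theorem MemSobolev.conj {σ : ℝ} {f : ℝ → ℂ} (hf : MemSobolev σ f) :
    ∃ h : MemSobolev σ fun x => starRingEnd ℂ (f x), ‖h.toLp‖ = ‖hf.toLp‖ := by
  have e : ∀ n, ‖weightedCoeff σ (fun x => starRingEnd ℂ (f x)) n‖ =
      ‖weightedCoeff σ f (-n)‖ := fun n => by
    rw [norm_weightedCoeff, norm_weightedCoeff, coeff_conj, RCLike.norm_conj, weight_neg]
  have hm : MemSobolev σ fun x => starRingEnd ℂ (f x) := by
    refine ⟨Complex.continuous_conj.comp hf.continuous, fun x => by simp only [hf.periodic x], ?_⟩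
    have h := hf.memℓp
    rw [memℓp_gen_iff (by norm_num)] at h ⊢
    simp only [e]
    exact ((Equiv.neg ℤ).summable_iff
      (f := fun n => ‖weightedCoeff σ f n‖ ^ (2 : ℝ≥0∞).toReal)).mpr h
  refine ⟨hm, ?_⟩
  rw [lp.norm_eq_tsum_rpow (by norm_num), lp.norm_eq_tsum_rpow (by norm_num)]
  congr 1
  show ∑' n, ‖weightedCoeff σ (fun x => starRingEnd ℂ (f x)) n‖ ^ (2 : ℝ≥0∞).toReal =
    ∑' n, ‖weightedCoeff σ f n‖ ^ (2 : ℝ≥0∞).toReal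
  simp only [e]
  exact (Equiv.neg ℤ).tsum_eq fun n => ‖weightedCoeff σ f n‖ ^ (2 : ℝ≥0∞).toReal

theorem MemSobolev.re {σ : ℝ} {f : ℝ → ℂ} (hf : MemSobolev σ f) :
    ∃ h : MemSobolev σ fun x => ((f x).re : ℂ), ‖h.toLp‖ ≤ ‖hf.toLp‖ := by
  obtain ⟨hc, hn⟩ := hf.conj
  have e : (fun x => ((f x).re : ℂ)) =
      fun x => (1 / 2 : ℂ) * (f x + starRingEnd ℂ (f x)) := by
    ext x; rw [Complex.add_conj]; push_cast; ring
  have hm : MemSobolev σ fun x => ((f x).re : ℂ) := by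
    rw [e]; exact (hf.add hc).const_mul _
  refine ⟨hm, ?_⟩
  have e2 : hm.toLp = (1 / 2 : ℂ) • (hf.toLp + hc.toLp) := by
    apply Subtype.ext
    show weightedCoeff σ (fun x => ((f x).re : ℂ)) =
      (1 / 2 : ℂ) • (weightedCoeff σ f + weightedCoeff σ _)
    rw [e, weightedCoeff_smul, weightedCoeff_add σ hf.continuous hc.continuous]
  rw [e2, norm_smul]
  have := norm_add_le hf.toLp hc.toLp
  rw [hn] at this
  norm_num
  linarith

theorem H.norm_def {σ : ℝ} (f : H σ) : ‖f‖ = ‖MemSobolev.toLp f.2‖ := rfl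

theorem H.ext {σ : ℝ} {f g : H σ} (h : ∀ x, f x = g x) : f = g := Subtype.ext (funext h)

section

variable {σ : ℝ} [hσ : Fact (1 / 2 < σ)]

/-- The inclusion of the real-valued into the complex-valued functions. -/
def ofH : H σ →L[ℝ] S σ :=
  LinearMap.mkContinuous
    { toFun := fun f => ⟨fun x => (f x : ℂ), f.2⟩
      map_add' := fun _ _ => S.ext fun _ => Complex.ofReal_add _ _
      map_smul' := fun _ _ => S.ext fun _ => Complex.ofReal_mul _ _ }
    (normConst σ) fun _ => (S.norm_def _).le

@[simp] theorem ofH_apply (f : H σ) (x : ℝ) : (ofH f : S σ) x = (f x : ℂ) := rfl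

/-- The real part. -/
def reH : S σ →L[ℝ] H σ :=
  LinearMap.mkContinuous
    { toFun := fun f => ⟨fun x => (f x).re, f.mem.re.1⟩
      map_add' := fun _ _ => H.ext fun _ => Complex.add_re _ _
      map_smul' := fun _ _ => H.ext fun _ => Complex.re_ofReal_mul _ _ }
    (normConst σ)⁻¹ fun f => f.mem.re.2.trans (S.norm_toLp f).le

@[simp] theorem reH_apply (f : S σ) (x : ℝ) : (reH f : H σ) x = (f x).re := rfl

end

/-! ### Differentiation and integration in Sobolev spaces -/

theorem hasDerivAt_character (n : ℤ) (x : ℝ) :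
    HasDerivAt (character n) (2 * Real.pi * Complex.I * n * character n x) x := by
  have := hasDerivAt_fourier 1 n x
  simp only [Complex.ofReal_one, div_one] at this
  exact this

/-- Differentiation multiplies the `n`-th Fourier coefficient by `2πin`. -/
theorem coeff_of_hasDerivAt {F g : ℝ → ℂ} (hg : Continuous g) (hF : Function.Periodic F 1)
    (h : ∀ x, HasDerivAt F (g x) x) (n : ℤ) :
    coeff g n = 2 * Real.pi * Complex.I * n * coeff F n := by
  have key := intervalIntegral.integral_mul_deriv_eq_deriv_mul (a := 0) (b := 1)
    (u := character (-n)) (v := F) (fun x _ => hasDerivAt_character (-n) x) (fun x _ => h x)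
    ((continuous_const.mul (continuous_character _)).intervalIntegrable _ _)
    (hg.intervalIntegrable _ _)
  have h0 : character (-n) 1 = character (-n) 0 := by
    simpa using periodic_character (-n) 0
  have h1 : F 1 = F 0 := by simpa using hF 0
  rw [h0, h1, sub_self, zero_sub] at key
  rw [coeff_def, coeff_def, key, ← intervalIntegral.integral_neg,
    ← intervalIntegral.integral_const_mul]
  congr 1
  ext x
  push_cast
  ring

theorem periodic_primitive {E : Type*} [NormedAddCommGroup E] [NormedSpace ℝ E] {g : ℝ → E}
    (hg : Continuous g) (hp : Function.Periodic g 1) (h0 : ∫ x in (0 : ℝ)..1, g x = 0) :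
    Function.Periodic (fun x => ∫ y in (0 : ℝ)..x, g y) 1 := fun x => by
  have h1 := intervalIntegral.integral_add_adjacent_intervals
    (hg.intervalIntegrable (μ := volume) 0 x) (hg.intervalIntegrable x (x + 1))
  have h2 := hp.intervalIntegral_add_eq x 0
  rw [zero_add, h0] at h2
  simp only [← h1, h2, add_zero]

theorem weight_eq_mul_sqrt (s : ℝ) (n : ℤ) :
    weight s n = weight (s - 1) n * √(1 + (n : ℝ) ^ 2) := by
  rw [weight, weight, Real.sqrt_eq_rpow, ← Real.rpow_add (by positivity)]
  congr 1
  ring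

/-- Functions of class `H^s`, `s > 3/2`, are differentiable with derivative of class `H^{s-1}`. -/
theorem MemSobolev.exists_deriv {s : ℝ} (hs : 3 / 2 < s) {f : ℝ → ℂ} (hf : MemSobolev s f) :
    ∃ g : ℝ → ℂ, ∃ hg : MemSobolev (s - 1) g, (∀ x, HasDerivAt f (g x) x) ∧
      ‖hg.toLp‖ ≤ 2 * Real.pi * ‖hf.toLp‖ := by
  have hb : ∀ n : ℤ, ‖(weight (s - 1) n : ℂ) * (2 * Real.pi * Complex.I * n * coeff f n)‖ ≤
      ‖((2 * Real.pi : ℂ) • weightedCoeff s f) n‖ := fun n => by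
    rw [Pi.smul_apply, smul_eq_mul, weightedCoeff_eq, weight_eq_mul_sqrt s n,
      Complex.ofReal_mul]
    simp only [norm_mul, Complex.norm_I, Complex.norm_real, mul_one, Complex.norm_intCast,
      Real.norm_of_nonneg (weight_pos (s - 1) n).le, Real.norm_of_nonneg (Real.sqrt_nonneg _)]
    have h1 : |(n : ℝ)| ≤ √(1 + (n : ℝ) ^ 2) := Real.abs_le_sqrt (by linarith)
    have h2 := (weight_pos (s - 1) n).le
    calc _ = ‖(2 : ℂ)‖ * ‖Real.pi‖ * weight (s - 1) n * ‖coeff f n‖ * |(n : ℝ)| := by ring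
      _ ≤ ‖(2 : ℂ)‖ * ‖Real.pi‖ * weight (s - 1) n * ‖coeff f n‖ * √(1 + (n : ℝ) ^ 2) := by gcongr
      _ = _ := by ring
  have hm : Memℓp (fun n : ℤ => (weight (s - 1) n : ℂ) *
      (2 * Real.pi * Complex.I * n * coeff f n)) 2 := (hf.memℓp.const_smul _).mono' hb
  obtain ⟨g, hg, hc⟩ := exists_memSobolev (by linarith) hm
  have h0 : ∫ x in (0 : ℝ)..1, g x = 0 := by
    have := congrFun hc 0
    rw [coeff_def] at this
    simpa [character_zero] using this
  have hp := periodic_primitive hg.continuous hg.periodic h0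
  have hd : ∀ x, HasDerivAt (fun x => ∫ y in (0 : ℝ)..x, g y) (g x) x := fun x =>
    hg.continuous.integral_hasStrictDerivAt 0 x |>.hasDerivAt
  have hGc : Continuous fun x => ∫ y in (0 : ℝ)..x, g y :=
    continuous_iff_continuousAt.mpr fun x => (hd x).continuousAt
  have hcG : ∀ n : ℤ, n ≠ 0 → coeff (fun x => ∫ y in (0 : ℝ)..x, g y) n = coeff f n := by
    intro n hn
    have h1 := coeff_of_hasDerivAt hg.continuous hp hd n
    rw [hc] at h1
    exact (mul_left_cancel₀ (by simp [hn, Real.pi_ne_zero]) h1).symm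
  -- `f` and the primitive of `g` have the same Fourier coefficients except the zeroth
  set G := fun x => ∫ y in (0 : ℝ)..x, g y
  obtain ⟨C, hC⟩ : ∃ C : ℂ, ∀ x, f x = G x + C := by
    refine ⟨coeff f 0 - coeff G 0, fun x => ?_⟩
    have hz := eq_zero_of_coeff (f := fun x => f x + (-1 * G x + (-(coeff f 0 - coeff G 0)) * 1))
      (hf.continuous.add ((continuous_const.mul hGc).add continuous_const))
      (fun x => by simp only [hf.periodic x, hp x]) fun n => by
        have c1 : Continuous fun x => -1 * G x := continuous_const.mul hGc
        have c2 : Continuous fun _ : ℝ => -(coeff f 0 - coeff G 0) * 1 := continuous_const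
        rw [coeff_add (g := fun x => -1 * G x + -(coeff f 0 - coeff G 0) * 1) hf.continuous
            (c1.add c2), coeff_add c1 c2, coeff_smul, coeff_smul, coeff_one]
        by_cases hn : n = 0
        · subst hn; rw [if_pos rfl]; ring
        · rw [hcG n hn]; simp [hn]
    have := congrFun hz x
    simp only [Pi.zero_apply] at this
    linear_combination this
  refine ⟨g, hg, fun x => ?_, ?_⟩
  · rw [show f = fun x => G x + C from funext hC]
    exact (hd x).add_const C
  · have e : ∀ n, ‖hg.toLp n‖ ≤ ‖((2 * Real.pi : ℂ) • hf.toLp) n‖ := fun n => by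
      refine le_trans (le_of_eq ?_) (hb n)
      show ‖(weight (s - 1) n : ℂ) * coeff g n‖ = _
      rw [hc]
    refine (lp.norm_mono (by norm_num) e).trans ?_
    rw [norm_smul, norm_mul, Complex.norm_real, Real.norm_of_nonneg Real.pi_pos.le]
    simp

/-- The primitive of a function of class `H^{s-1}` with mean zero is of class `H^s`. -/
theorem MemSobolev.primitive {s : ℝ} {g : ℝ → ℂ} (hg : MemSobolev (s - 1) g)
    (h0 : ∫ x in (0 : ℝ)..1, g x = 0) : MemSobolev s fun x => ∫ y in (0 : ℝ)..x, g y := by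
  have hp := periodic_primitive hg.continuous hg.periodic h0
  have hd : ∀ x, HasDerivAt (fun x => ∫ y in (0 : ℝ)..x, g y) (g x) x := fun x =>
    hg.continuous.integral_hasStrictDerivAt 0 x |>.hasDerivAt
  set G := fun x => ∫ y in (0 : ℝ)..x, g y with hG
  have hGc : Continuous G := continuous_iff_continuousAt.mpr fun x => (hd x).continuousAt
  have key : MemSobolev s fun x => G x + -coeff G 0 * 1 := by
    refine ⟨hGc.add continuous_const, fun x => by simp only [hp x], ?_⟩
    refine hg.memℓp.mono' fun n => ?_
    rw [norm_weightedCoeff, norm_weightedCoeff, coeff_add hGc continuous_const, coeff_smul,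
      coeff_one, weight_eq_mul_sqrt, coeff_of_hasDerivAt hg.continuous hp hd]
    by_cases hn : n = 0
    · subst hn; simp
    · simp only [hn, if_false, mul_zero, add_zero, norm_mul, Complex.norm_I, Complex.norm_real,
        mul_one, Complex.norm_intCast, Real.norm_of_nonneg Real.pi_pos.le, Complex.norm_ofNat]
      have h1 : (1 : ℝ) ≤ |(n : ℝ)| := by
        exact_mod_cast Int.one_le_abs hn
      have h2 : √(1 + (n : ℝ) ^ 2) ≤ 2 * Real.pi * |(n : ℝ)| := by
        rw [Real.sqrt_le_left (by positivity), mul_pow, sq_abs]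
        have h4 : 1 ≤ (n : ℝ) ^ 2 := by rw [← sq_abs]; exact one_le_pow₀ h1
        have h5 : 9 < Real.pi ^ 2 := by nlinarith [Real.pi_gt_three]
        nlinarith
      have h3 := (weight_pos (s - 1) n).le
      rw [mul_assoc]
      gcongr
  have := key.add (memSobolev_const s (coeff G 0))
  simpa using this

section

variable {s : ℝ}

theorem H.exists_deriv (hs : 3 / 2 < s) (f : H s) :
    ∃ hg : MemSobolev (s - 1) fun x => ((deriv f x : ℝ) : ℂ),
      (∀ x, HasDerivAt f (deriv f x) x) ∧ ‖hg.toLp‖ ≤ 2 * Real.pi * ‖f‖ := by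
  obtain ⟨g, hg, hd, hn⟩ := MemSobolev.exists_deriv hs f.2
  have hd1 : ∀ x, HasDerivAt f (g x).re x := fun x =>
    Complex.reCLM.hasFDerivAt.comp_hasDerivAt x (hd x)
  have hgr : g = fun x => ((deriv f x : ℝ) : ℂ) := by
    ext x
    rw [(hd1 x).deriv]
    exact (hd x).unique (hd1 x).ofReal_comp
  subst hgr
  exact ⟨hg, fun x => (hd1 x).differentiableAt.hasDerivAt, hn⟩

theorem H.hasDerivAt (hs : 3 / 2 < s) (f : H s) (x : ℝ) : HasDerivAt f (deriv f x) x :=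
  (f.exists_deriv hs).2.1 x

theorem H.continuous (f : H s) : Continuous f :=
  Complex.continuous_re.comp f.2.continuous

theorem H.periodic (f : H s) : Function.Periodic f 1 := fun x =>
  Complex.ofReal_injective (f.2.periodic x)

/-- The derivative of `f ∈ H^s` as an element of `H^{s-1}`. -/
def H.derivH (hs : 3 / 2 < s) (f : H s) : H (s - 1) := ⟨deriv f, (f.exists_deriv hs).1⟩

theorem H.continuous_deriv (hs : 3 / 2 < s) (f : H s) : Continuous (deriv f) :=
  (f.derivH hs).continuous

theorem H.integral_deriv (hs : 3 / 2 < s) (f : H s) (a b : ℝ) :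
    ∫ x in a..b, deriv f x = f b - f a :=
  intervalIntegral.integral_eq_sub_of_hasDerivAt (fun x _ => f.hasDerivAt hs x)
    ((f.continuous_deriv hs).intervalIntegrable _ _)

/-- The primitive, vanishing at `0`, of a function of class `H^{s-1}` with mean zero. -/
def H.primitive (g : H (s - 1)) (h0 : ∫ x in (0 : ℝ)..1, g x = 0) : H₀ s :=
  ⟨⟨fun x => ∫ y in (0 : ℝ)..x, g y, by
    have := MemSobolev.primitive (s := s) g.2 (by rw [intervalIntegral.integral_ofReal, h0]; rfl)
    simp only [intervalIntegral.integral_ofReal] at this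
    exact this⟩,
    intervalIntegral.integral_same⟩

theorem H.deriv_primitive (g : H (s - 1)) (h0 : ∫ x in (0 : ℝ)..1, g x = 0) (x : ℝ) :
    deriv (H.primitive g h0 : H s) x = g x :=
  (g.continuous.integral_hasStrictDerivAt 0 x).hasDerivAt.deriv

theorem H₀.apply_zero (u : H₀ s) : (u : H s) 0 = 0 := u.2

theorem H₀.apply_one (f : H₀ s) : (f : H s) 1 = 0 := by
  have : (f : H s) 1 = (f : H s) 0 := by simpa using (f : H s).periodic 0
  rw [this, H₀.apply_zero]

variable [hσ : Fact (1 / 2 < s - 1)]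

theorem three_halves_lt : 3 / 2 < s := by linarith [hσ.out]

theorem H.deriv_add (f g : H s) (x : ℝ) : deriv (f + g : H s) x = deriv f x + deriv g x :=
  ((f.hasDerivAt three_halves_lt x).add (g.hasDerivAt three_halves_lt x)).deriv

theorem H.deriv_smul (a : ℝ) (f : H s) (x : ℝ) : deriv (a • f : H s) x = a * deriv f x :=
  ((f.hasDerivAt three_halves_lt x).const_mul a).deriv

/-- Differentiation as a bounded operator `H₀^s(S¹; ℝ) → H^{s-1}(S¹; ℂ)`. -/
def derivS : H₀ s →L[ℝ] S (s - 1) :=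
  LinearMap.mkContinuous
    { toFun := fun f => ⟨fun x => ((deriv (f : H s) x : ℝ) : ℂ),
        ((f : H s).exists_deriv three_halves_lt).1⟩
      map_add' := fun f g => S.ext fun x =>
        (congrArg Complex.ofReal (H.deriv_add (f : H s) g x)).trans (Complex.ofReal_add _ _)
      map_smul' := fun a f => S.ext fun x =>
        (congrArg Complex.ofReal (H.deriv_smul a (f : H s) x)).trans (Complex.ofReal_mul _ _) }
    (normConst (s - 1) * (2 * Real.pi)) fun f => by
      rw [mul_assoc]
      refine (S.norm_def _).le.trans ?_
      exact mul_le_mul_of_nonneg_left ((f : H s).exists_deriv three_halves_lt).2.2 normConst_pos.le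

@[simp] theorem derivS_apply (f : H₀ s) (x : ℝ) :
    (derivS f : S (s - 1)) x = ((deriv (f : H s) x : ℝ) : ℂ) := rfl

theorem mean_derivS (f : H₀ s) : S.mean (derivS f : S (s - 1)) = 0 := by
  rw [S.mean_apply]
  simp only [derivS_apply]
  rw [intervalIntegral.integral_ofReal, H.integral_deriv three_halves_lt]
  rw [H₀.apply_one, H₀.apply_zero, sub_self, Complex.ofReal_zero]

end

/-! ### The diffeomorphism `φ` and the right-invariant metric in Lagrangian variables -/

namespace G

variable {s : ℝ}

/-- The Jacobian `φₓ = 1 + hₓ`. -/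
def jac (p : G s) (x : ℝ) : ℝ := 1 + deriv (p.h : H s) x

theorem jac_pos (p : G s) (x : ℝ) : 0 < p.jac x := by
  have := p.neg_one_lt_deriv x
  unfold jac; linarith

theorem hasDerivAt_φ (hs : 3 / 2 < s) (p : G s) (x : ℝ) : HasDerivAt p.φ (p.jac x) x :=
  (hasDerivAt_id x).add ((p.h : H s).hasDerivAt hs x)

theorem continuous_jac (hs : 3 / 2 < s) (p : G s) : Continuous p.jac :=
  continuous_const.add ((p.h : H s).continuous_deriv hs)

theorem φ_zero (p : G s) : p.φ 0 = 0 := by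
  rw [φ, H₀.apply_zero, add_zero]

theorem φ_one (p : G s) : p.φ 1 = 1 := by
  rw [φ, H₀.apply_one, add_zero]

theorem strictMono_φ (hs : 3 / 2 < s) (p : G s) : StrictMono p.φ :=
  strictMono_of_deriv_pos fun x => by
    rw [(p.hasDerivAt_φ hs x).deriv]; exact p.jac_pos x

theorem continuous_φ (p : G s) : Continuous p.φ := continuous_id.add (p.h : H s).continuous

theorem surjective_φ (hs : 3 / 2 < s) (p : G s) : Function.Surjective p.φ := by
  obtain ⟨M, hM⟩ : ∃ M, ∀ x, |(p.h : H s) x| ≤ M := ⟨_, fun x => by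
    have := (p.h : H s).2.norm_apply_le (by linarith) x
    rwa [Complex.norm_real, Real.norm_eq_abs] at this⟩
  exact p.continuous_φ.surjective
    (tendsto_atTop_add_right_of_le _ (-M) tendsto_id fun x => (abs_le.mp (hM x)).1)
    (tendsto_atBot_add_right_of_ge _ M tendsto_id fun x => (abs_le.mp (hM x)).2)

theorem φInv_φ (hs : 3 / 2 < s) (p : G s) (x : ℝ) : p.φInv (p.φ x) = x :=
  Function.leftInverse_invFun (p.strictMono_φ hs).injective x

theorem φ_φInv (hs : 3 / 2 < s) (p : G s) (x : ℝ) : p.φ (p.φInv x) = x :=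
  Function.rightInverse_invFun (p.surjective_φ hs) x

theorem continuous_φInv (hs : 3 / 2 < s) (p : G s) : Continuous p.φInv := by
  let e := (p.strictMono_φ hs).orderIsoOfSurjective p.φ (p.surjective_φ hs)
  have he : p.φInv = e.symm := by
    ext y
    apply e.injective
    rw [e.apply_symm_apply]
    exact p.φ_φInv hs y
  rw [he]
  exact e.symm.continuous

theorem hasDerivAt_φInv (hs : 3 / 2 < s) (p : G s) (y : ℝ) :
    HasDerivAt p.φInv (p.jac (p.φInv y))⁻¹ y :=
  HasDerivAt.of_local_left_inverse (p.continuous_φInv hs).continuousAt (p.hasDerivAt_φ hs _)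
    (p.jac_pos _).ne' (Eventually.of_forall (p.φ_φInv hs))

/-- Change of variables along `φ`. -/
theorem integral_comp_φ (hs : 3 / 2 < s) (p : G s) {F : ℝ → ℝ} (hF : Continuous F) (x : ℝ) :
    ∫ y in (0 : ℝ)..x, F (p.φ y) * p.jac y = ∫ y in (0 : ℝ)..p.φ x, F y := by
  have := intervalIntegral.integral_comp_mul_deriv (a := 0) (b := x) (f := p.φ) (f' := p.jac)
    (g := F) (fun x _ => p.hasDerivAt_φ hs x) (p.continuous_jac hs).continuousOn hF
  rw [p.φ_zero] at this
  exact this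

/-- The density `(φ_{tx}² / φₓ) + α_t² φₓ` of four times the kinetic energy, in Lagrangian
variables. -/
def density (p : G s) (U : TG s) (x : ℝ) : ℝ :=
  deriv (U.1 : H s) x ^ 2 / p.jac x + U.2 x ^ 2 * p.jac x

theorem deriv_toId_fst (hs : 3 / 2 < s) (p : G s) (U : TG s) (y : ℝ) :
    deriv (p.toId U).1 y = deriv (U.1 : H s) (p.φInv y) / p.jac (p.φInv y) := by
  have := ((U.1 : H s).hasDerivAt hs (p.φInv y)).comp y (p.hasDerivAt_φInv hs y)
  exact this.deriv

/-- The Eulerian density `u₁ₓ² + u₂²` of four times the kinetic energy. -/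
def eulerDensity (p : G s) (U : TG s) (y : ℝ) : ℝ :=
  deriv (p.toId U).1 y * deriv (p.toId U).1 y + (p.toId U).2 y * (p.toId U).2 y

theorem eulerDensity_eq (hs : 3 / 2 < s) (p : G s) (U : TG s) (y : ℝ) :
    p.eulerDensity U y =
      (deriv (U.1 : H s) (p.φInv y) / p.jac (p.φInv y)) ^ 2 + U.2 (p.φInv y) ^ 2 := by
  rw [eulerDensity, p.deriv_toId_fst hs, sq, sq]
  rfl

theorem eulerDensity_mul_jac (hs : 3 / 2 < s) (p : G s) (U : TG s) (x : ℝ) :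
    p.eulerDensity U (p.φ x) * p.jac x = p.density U x := by
  rw [p.eulerDensity_eq hs, p.φInv_φ hs, density]
  have := (p.jac_pos x).ne'
  field_simp

/-- For `s > 5/2` the Eulerian energy density is continuously differentiable. -/
theorem exists_deriv_eulerDensity (hs : 5 / 2 < s) (p : G s) (U : TG s) :
    ∃ q : ℝ → ℝ, Continuous q ∧ ∀ y, HasDerivAt (p.eulerDensity U) (q y) y := by
  have hs' : 3 / 2 < s := by linarith
  have hs1 : 3 / 2 < s - 1 := by linarith
  -- the derivative of the density in Lagrangian variables
  let v := (U.1 : H s).derivH hs'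
  let j := (p.h : H s).derivH hs'
  let r : ℝ → ℝ := fun x =>
    2 * (deriv (U.1 : H s) x / p.jac x) ^ 1 *
      ((deriv v x * p.jac x - deriv (U.1 : H s) x * deriv j x) / p.jac x ^ 2) +
      2 * U.2 x ^ 1 * deriv U.2 x
  have hv : ∀ x, HasDerivAt (deriv (U.1 : H s)) (deriv v x) x := v.hasDerivAt hs1
  have hj : ∀ x, HasDerivAt p.jac (deriv j x) x := fun x => (j.hasDerivAt hs1 x).const_add 1
  have hr : ∀ x, HasDerivAt
      (fun x => (deriv (U.1 : H s) x / p.jac x) ^ 2 + U.2 x ^ 2) (r x) x := fun x =>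
    (((hv x).div (hj x) (p.jac_pos x).ne').pow 2).add ((U.2.hasDerivAt hs1 x).pow 2)
  have c1 := (U.1 : H s).continuous_deriv hs'
  have c2 := p.continuous_jac hs'
  have c3 := v.continuous_deriv hs1
  have c4 := j.continuous_deriv hs1
  have c5 := U.2.continuous_deriv hs1
  have c6 := U.2.continuous
  have hrc : Continuous r := by
    refine Continuous.add (Continuous.mul (continuous_const.mul
      ((c1.div c2 fun x => (p.jac_pos x).ne').pow 1)) ?_) ((continuous_const.mul (c6.pow 1)).mul c5)
    exact ((c3.mul c2).sub (c1.mul c4)).div (c2.pow 2) fun x => (pow_pos (p.jac_pos x) 2).ne'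
  refine ⟨fun y => r (p.φInv y) * (p.jac (p.φInv y))⁻¹,
    (hrc.comp (p.continuous_φInv hs')).mul
      ((c2.comp (p.continuous_φInv hs')).inv₀ fun x => (p.jac_pos _).ne'), fun y => ?_⟩
  rw [show p.eulerDensity U =
    (fun x => (deriv (U.1 : H s) x / p.jac x) ^ 2 + U.2 x ^ 2) ∘ p.φInv from
      funext fun y => p.eulerDensity_eq hs' U y]
  exact (hr _).comp y (p.hasDerivAt_φInv hs' y)

theorem continuous_eulerDensity (hs : 5 / 2 < s) (p : G s) (U : TG s) :
    Continuous (p.eulerDensity U) := by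
  obtain ⟨q, -, hd⟩ := p.exists_deriv_eulerDensity hs U
  exact continuous_iff_continuousAt.mpr fun x => (hd x).continuousAt

theorem integral_density (hs : 5 / 2 < s) (p : G s) (U : TG s) (x : ℝ) :
    ∫ y in (0 : ℝ)..x, p.density U y = ∫ y in (0 : ℝ)..p.φ x, p.eulerDensity U y := by
  rw [← p.integral_comp_φ (by linarith) (p.continuous_eulerDensity hs U)]
  simp only [p.eulerDensity_mul_jac (by linarith : 3 / 2 < s)]

end G

/-- `A⁻¹∂ₓ` is a primitive corrected by a linear function; the value `F 0` drops out. -/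
theorem AInv_deriv {F q : ℝ → ℝ} (hq : Continuous q) (hF : ∀ y, HasDerivAt F (q y) y) (x : ℝ) :
    AInv (deriv F) x = -(∫ y in (0 : ℝ)..x, F y) + x * ∫ y in (0 : ℝ)..1, F y := by
  have hFc : Continuous F := continuous_iff_continuousAt.mpr fun x => (hF x).continuousAt
  have e : deriv F = q := funext fun y => (hF y).deriv
  have h1 : ∀ y, ∫ z in (0 : ℝ)..y, deriv F z = F y - F 0 := fun y => by
    rw [e]
    exact intervalIntegral.integral_eq_sub_of_hasDerivAt (fun z _ => hF z)
      (hq.intervalIntegrable _ _)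
  have h2 : ∀ x : ℝ, ∫ y in (0 : ℝ)..x, (F y - F 0) = (∫ y in (0 : ℝ)..x, F y) - x * F 0 := by
    intro x
    rw [intervalIntegral.integral_sub (hFc.intervalIntegrable _ _) intervalIntegrable_const]
    simp
  simp only [AInv, h1, h2]
  ring

namespace G

variable {s : ℝ}

/-- The Christoffel map in Lagrangian variables. -/
theorem christoffel_eq (hs : 5 / 2 < s) (p : G s) (U : TG s) :
    christoffel p U U =
      (fun x => 1 / 2 * (∫ y in (0 : ℝ)..x, p.density U y) -
          1 / 2 * p.φ x * ∫ y in (0 : ℝ)..1, p.density U y,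
        fun x => -(deriv (U.1 : H s) x * U.2 x / p.jac x)) := by
  have hs' : 3 / 2 < s := by linarith
  obtain ⟨q, hq, hd⟩ := p.exists_deriv_eulerDensity hs U
  refine Prod.ext (funext fun x => ?_) (funext fun x => ?_)
  · have h := AInv_deriv hq hd (p.φ x)
    rw [← p.integral_density hs] at h
    have h1 := p.integral_density hs U 1
    rw [p.φ_one] at h1
    rw [← h1] at h
    show -(1 / 2) * AInv (deriv (p.eulerDensity U)) (p.φ x) = _
    rw [h]
    ring
  · show -(1 / 2) * (deriv (p.toId U).1 (p.φ x) * U.2 (p.φInv (p.φ x)) +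
      deriv (p.toId U).1 (p.φ x) * U.2 (p.φInv (p.φ x))) = _
    rw [p.deriv_toId_fst hs', p.φInv_φ hs']
    ring

/-- The metric in Lagrangian variables. -/
theorem metric_eq (hs : 5 / 2 < s) (p : G s) (U : TG s) :
    metric p U U = 1 / 4 * ∫ y in (0 : ℝ)..1, p.density U y := by
  rw [p.integral_density hs, p.φ_one]
  rfl

end G

/-! ### Calculus on the time interval -/

theorem hasDerivAt_cos_mul (c t : ℝ) :
    HasDerivAt (fun τ => Real.cos (c * τ)) (-(c * Real.sin (c * t))) t := by
  have h1 : HasDerivAt (fun τ => c * τ) c t := by simpa using (hasDerivAt_id t).const_mul c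
  exact h1.cos.congr_deriv (by ring)

theorem hasDerivAt_sin_mul (c t : ℝ) :
    HasDerivAt (fun τ => Real.sin (c * τ)) (c * Real.cos (c * t)) t := by
  have h1 : HasDerivAt (fun τ => c * τ) c t := by simpa using (hasDerivAt_id t).const_mul c
  exact h1.sin.congr_deriv (by ring)

section TimeInterval

variable {T : ℝ≥0∞}

theorem zero_mem_timeInterval (hT : 0 < T) : (0 : ℝ) ∈ timeInterval T := ⟨le_rfl, by simpa⟩

theorem mem_timeInterval_of_le {t τ : ℝ} (ht : t ∈ timeInterval T) (h0 : 0 ≤ τ) (h : τ ≤ t) :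
    τ ∈ timeInterval T :=
  ⟨h0, (ENNReal.ofReal_le_ofReal h).trans_lt ht.2⟩

theorem convex_timeInterval : Convex ℝ (timeInterval T) :=
  Set.OrdConnected.convex ⟨fun _ hx _ hy _ hz => mem_timeInterval_of_le hy (hx.1.trans hz.1) hz.2⟩

theorem exists_pos_mem_timeInterval (hT : 0 < T) : ∃ ε : ℝ, 0 < ε ∧ ε ∈ timeInterval T := by
  obtain ⟨ε, h0, h1⟩ := ENNReal.lt_iff_exists_real_btwn.mp hT
  exact ⟨ε, ENNReal.ofReal_pos.mp h1.1, ⟨h0, h1.2⟩⟩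

theorem uniqueDiffOn_timeInterval (hT : 0 < T) : UniqueDiffOn ℝ (timeInterval T) := by
  obtain ⟨ε, h0, h1⟩ := exists_pos_mem_timeInterval hT
  refine uniqueDiffOn_convex convex_timeInterval ⟨ε / 2, ?_⟩
  exact interior_maximal (t := Ioo 0 ε)
    (fun τ hτ => mem_timeInterval_of_le h1 hτ.1.le hτ.2.le) isOpen_Ioo ⟨by linarith, by linarith⟩

theorem timeInterval_mono {T' : ℝ≥0∞} (h : T ≤ T') : timeInterval T ⊆ timeInterval T' :=
  fun _ ht => ⟨ht.1, ht.2.trans_le h⟩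

variable {E : Type*} [NormedAddCommGroup E] [NormedSpace ℝ E]

theorem eq_initial_of_hasDerivWithinAt_zero {f : ℝ → E}
    (h : ∀ t ∈ timeInterval T, HasDerivWithinAt f 0 (timeInterval T) t) {t : ℝ}
    (ht : t ∈ timeInterval T) : f t = f 0 := by
  refine convex_timeInterval.is_const_of_fderivWithin_eq_zero (𝕜 := ℝ)
    (fun τ hτ => (h τ hτ).differentiableWithinAt) (fun τ hτ => ?_) ht
    (mem_timeInterval_of_le ht le_rfl ht.1)
  have h1 := (h τ hτ).hasFDerivWithinAt.fderivWithin
    (uniqueDiffOn_timeInterval (bot_le.trans_lt hτ.2) τ hτ)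
  rw [h1]
  ext
  simp

/-- The solution of the harmonic oscillator `y'' = -k² y`. -/
theorem eq_of_oscillator {k : ℝ} (hk : k ≠ 0) {y v : ℝ → E}
    (hy : ∀ t ∈ timeInterval T, HasDerivWithinAt y (v t) (timeInterval T) t)
    (hv : ∀ t ∈ timeInterval T, HasDerivWithinAt v (-k ^ 2 • y t) (timeInterval T) t)
    {t : ℝ} (ht : t ∈ timeInterval T) :
    y t = Real.cos (k * t) • y 0 + (Real.sin (k * t) / k) • v 0 := by
  have hc := hasDerivAt_cos_mul k
  have hsn := hasDerivAt_sin_mul k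
  -- rotating the phase plane back by the angle `kt` gives two conserved quantities
  have q1 := eq_initial_of_hasDerivWithinAt_zero
    (f := fun τ => Real.cos (k * τ) • y τ - (Real.sin (k * τ) / k) • v τ) (fun τ hτ => by
      refine (((hc τ).hasDerivWithinAt.smul (hy τ hτ)).sub
        (((hsn τ).div_const k).hasDerivWithinAt.smul (hv τ hτ))).congr_deriv ?_
      match_scalars <;> field_simp <;> ring) ht
  have q2 := eq_initial_of_hasDerivWithinAt_zero
    (f := fun τ => (k * Real.sin (k * τ)) • y τ + Real.cos (k * τ) • v τ) (fun τ hτ => by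
      refine ((((hsn τ).const_mul k).hasDerivWithinAt.smul (hy τ hτ)).add
        ((hc τ).hasDerivWithinAt.smul (hv τ hτ))).congr_deriv ?_
      match_scalars <;> ring) ht
  simp only [mul_zero, Real.cos_zero, Real.sin_zero, zero_div, zero_smul, one_smul, sub_zero,
    zero_add] at q1 q2
  rw [← q1, ← q2]
  have h1 := Real.sin_sq_add_cos_sq (k * t)
  match_scalars
  · field_simp; linear_combination -h1
  · field_simp; ring

end TimeInterval

/-! ### Great circles -/

/-- The real part `cos ct + u₀ₓ sin ct / 2c` of the great circle. -/
def gcRe (c : ℝ) (u₀ : ℝ → ℝ) (t x : ℝ) : ℝ :=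
  Real.cos (c * t) + deriv u₀ x / (2 * c) * Real.sin (c * t)

/-- The imaginary part `ρ₀ sin ct / 2c` of the great circle. -/
def gcIm (c : ℝ) (ρ₀ : ℝ → ℝ) (t x : ℝ) : ℝ := ρ₀ x / (2 * c) * Real.sin (c * t)

theorem greatCircle_eq (c : ℝ) (u₀ ρ₀ : ℝ → ℝ) (t x : ℝ) :
    greatCircle c u₀ ρ₀ t x = (gcRe c u₀ t x : ℂ) + (gcIm c ρ₀ t x : ℂ) * Complex.I := by
  unfold greatCircle gcRe gcIm
  push_cast
  ring

/-- The squared modulus of the great circle. -/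
def gcSq (c : ℝ) (u₀ ρ₀ : ℝ → ℝ) (t x : ℝ) : ℝ := gcRe c u₀ t x ^ 2 + gcIm c ρ₀ t x ^ 2

theorem norm_greatCircle_sq (c : ℝ) (u₀ ρ₀ : ℝ → ℝ) (t x : ℝ) :
    ‖greatCircle c u₀ ρ₀ t x‖ ^ 2 = gcSq c u₀ ρ₀ t x := by
  rw [greatCircle_eq, Complex.sq_norm, Complex.normSq_add_mul_I, gcSq]

theorem greatCircle_ne_zero_iff (c : ℝ) (u₀ ρ₀ : ℝ → ℝ) (t x : ℝ) :
    greatCircle c u₀ ρ₀ t x ≠ 0 ↔ 0 < gcSq c u₀ ρ₀ t x := by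
  rw [← norm_greatCircle_sq, ← norm_pos_iff]
  exact ⟨fun h => by positivity, fun h => by
    rcases (norm_nonneg (greatCircle c u₀ ρ₀ t x)).lt_or_eq with h1 | h1
    · exact h1
    · rw [← h1] at h; simp at h⟩

theorem hasDerivAt_gcRe (c : ℝ) (u₀ : ℝ → ℝ) (t x : ℝ) :
    HasDerivAt (fun τ => gcRe c u₀ τ x)
      (-(c * Real.sin (c * t)) + deriv u₀ x / (2 * c) * (c * Real.cos (c * t))) t := by
  exact (hasDerivAt_cos_mul c t).add ((hasDerivAt_sin_mul c t).const_mul _)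

theorem hasDerivAt_gcIm (c : ℝ) (ρ₀ : ℝ → ℝ) (t x : ℝ) :
    HasDerivAt (fun τ => gcIm c ρ₀ τ x) (ρ₀ x / (2 * c) * (c * Real.cos (c * t))) t := by
  exact (hasDerivAt_sin_mul c t).const_mul _

theorem hasDerivWithinAt_ringInverse {R : Type*} [NormedCommRing R] [NormedAlgebra ℝ R]
    [CompleteSpace R] {f : ℝ → R} {f' : R} {I : Set ℝ} {t : ℝ} (hu : IsUnit (f t))
    (hf : HasDerivWithinAt f f' I t) :
    HasDerivWithinAt (fun τ => Ring.inverse (f τ)) (-(Ring.inverse (f t) ^ 2 * f')) I t := by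
  obtain ⟨u, hu⟩ := hu
  have h := hasFDerivAt_ringInverse (𝕜 := ℝ) u
  rw [hu] at h
  refine (h.comp_hasDerivWithinAt t hf).congr_deriv ?_
  rw [← hu, Ring.inverse_unit]
  simp only [neg_apply, ContinuousLinearMap.mulLeftRight_apply]
  ring

/-! ### Geodesics with given initial data -/

theorem HasVelocityWithinAt.mono {s : ℝ} {γ : ℝ → G s} {v : TG s} {I J : Set ℝ} {t : ℝ}
    (h : HasVelocityWithinAt γ v J t) (hIJ : I ⊆ J) : HasVelocityWithinAt γ v I t where
  fst := h.fst.mono hIJ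
  snd := by
    obtain ⟨β, h0, hev, hd⟩ := h.snd
    exact ⟨β, h0, hev.filter_mono (nhdsWithin_mono t hIJ), hd.mono hIJ⟩

theorem TG.ext_fn {s : ℝ} {U V : TG s} (h : U.fn = V.fn) : U = V :=
  Prod.ext (Subtype.ext (H.ext fun x => congrFun (congrArg Prod.fst h) x))
    (H.ext fun x => congrFun (congrArg Prod.snd h) x)

theorem G.jac_one {s : ℝ} (x : ℝ) : (G.one s).jac x = 1 := by
  have e : ((((0 : H₀ s) : H s)) : ℝ → ℝ) = fun _ => 0 := rfl
  show 1 + deriv (((0 : H₀ s) : H s)) x = 1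
  rw [e]
  simp

theorem IsGeodesic.hasDerivWithinAt_velocity {s : ℝ} {T : ℝ≥0∞} {γ : ℝ → G s} {γ' : ℝ → TG s}
    (hγ : IsGeodesic s T γ γ') {t : ℝ} (ht : t ∈ timeInterval T) :
    HasDerivWithinAt γ' (derivWithin γ' (timeInterval T) t) (timeInterval T) t :=
  ((hγ.smooth.differentiableOn (by simp)) t ht).hasDerivWithinAt

section Uniqueness

variable {s : ℝ} [hσ : Fact (1 / 2 < s - 1)] {T : ℝ≥0∞} {γ : ℝ → G s} {γ' : ℝ → TG s}

/-- The Jacobian `φₓ` as an element of the Banach algebra `H^{s-1}(S¹; ℂ)`. -/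
def jacS (h : H₀ s) : S (s - 1) := 1 + derivS h

theorem jacS_apply (p : G s) (x : ℝ) : (jacS p.h : S (s - 1)) x = (p.jac x : ℂ) := by
  simp [jacS, G.jac]

theorem isUnit_jacS (p : G s) : IsUnit (jacS p.h : S (s - 1)) :=
  S.isUnit_of_ne_zero fun x => by
    rw [jacS_apply]; exact Complex.ofReal_ne_zero.mpr (p.jac_pos x).ne'

theorem inverse_jacS_apply (p : G s) (x : ℝ) :
    (Ring.inverse (jacS p.h) : S (s - 1)) x = ((p.jac x)⁻¹ : ℝ) := by
  rw [S.inverse_apply (isUnit_jacS p), jacS_apply, Complex.ofReal_inv]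

theorem G.continuous_density (p : G s) (U : TG s) : Continuous (p.density U) :=
  ((((U.1 : H s).continuous_deriv three_halves_lt).pow 2).div (p.continuous_jac three_halves_lt)
    fun x => (p.jac_pos x).ne').add ((U.2.continuous.pow 2).mul (p.continuous_jac three_halves_lt))

/-- The energy density as an element of the Banach algebra `H^{s-1}(S¹; ℂ)`. -/
def densityS (p : G s) (U : TG s) : S (s - 1) :=
  (derivS U.1 ^ 2 + (jacS p.h * ofH U.2) ^ 2) * Ring.inverse (jacS p.h)

theorem densityS_apply (p : G s) (U : TG s) (x : ℝ) :
    densityS p U x = (p.density U x : ℂ) := by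
  have h : (p.jac x : ℂ) ≠ 0 := Complex.ofReal_ne_zero.mpr (p.jac_pos x).ne'
  simp only [densityS, S.mul_apply, S.add_apply, S.pow_apply, jacS_apply, ofH_apply, derivS_apply,
    inverse_jacS_apply, G.density]
  push_cast
  field_simp

theorem mean_densityS (p : G s) (U : TG s) :
    S.mean (densityS p U) = ((∫ x in (0 : ℝ)..1, p.density U x : ℝ) : ℂ) := by
  rw [S.mean_apply, ← intervalIntegral.integral_ofReal]
  simp only [densityS_apply]

namespace IsGeodesic

theorem hasDerivWithinAt_jacS (hγ : IsGeodesic s T γ γ') {t : ℝ} (ht : t ∈ timeInterval T) :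
    HasDerivWithinAt (fun τ => jacS (γ τ).h) (derivS (γ' t).1) (timeInterval T) t :=
  ((derivS (s := s)).hasFDerivAt.comp_hasDerivWithinAt t (hγ.velocity t ht).fst).const_add 1

theorem hasDerivWithinAt_derivS (hγ : IsGeodesic s T γ γ') {t : ℝ} (ht : t ∈ timeInterval T) :
    HasDerivWithinAt (fun τ => derivS (γ' τ).1)
      (derivS (derivWithin γ' (timeInterval T) t).1) (timeInterval T) t :=
  ((derivS (s := s)).comp (ContinuousLinearMap.fst ℝ (H₀ s)
    (H (s - 1)))).hasFDerivAt.comp_hasDerivWithinAt t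
    (hγ.hasDerivWithinAt_velocity ht)

theorem hasDerivWithinAt_ofH (hγ : IsGeodesic s T γ γ') {t : ℝ} (ht : t ∈ timeInterval T) :
    HasDerivWithinAt (fun τ => (ofH (γ' τ).2 : S (s - 1)))
      (ofH (derivWithin γ' (timeInterval T) t).2) (timeInterval T) t :=
  ((ofH (σ := s - 1)).comp (ContinuousLinearMap.snd ℝ (H₀ s) _)).hasFDerivAt.comp_hasDerivWithinAt t
    (hγ.hasDerivWithinAt_velocity ht)

/-- The second component of the geodesic equation, `φₓ α_tt = -φ_tx α_t`. -/
theorem jacS_mul_accel (hs : 5 / 2 < s) (hγ : IsGeodesic s T γ γ') {t : ℝ}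
    (ht : t ∈ timeInterval T) :
    (jacS (γ t).h * ofH (derivWithin γ' (timeInterval T) t).2 : S (s - 1)) =
      -(derivS (γ' t).1 * ofH (γ' t).2) := by
  have h := hγ.equation t ht
  rw [G.christoffel_eq hs] at h
  have h2 : ∀ x, (derivWithin γ' (timeInterval T) t).2 x = _ := congrFun (congrArg Prod.snd h)
  ext x
  simp only [S.mul_apply, S.neg_apply, jacS_apply, ofH_apply, derivS_apply, h2]
  have := (γ t).jac_pos x
  rw [← Complex.ofReal_mul, ← Complex.ofReal_mul, ← Complex.ofReal_neg]
  congr 1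
  field_simp

/-- The derivative in `x` of the first component of the geodesic equation. -/
theorem derivS_accel (hs : 5 / 2 < s) (hγ : IsGeodesic s T γ γ') {t : ℝ}
    (ht : t ∈ timeInterval T) :
    (derivS (derivWithin γ' (timeInterval T) t).1 : S (s - 1)) =
      (1 / 2 : ℂ) • (densityS (γ t) (γ' t) -
        S.mean (densityS (γ t) (γ' t)) • jacS (γ t).h) := by
  have h := hγ.equation t ht
  rw [G.christoffel_eq hs] at h
  have h1 : ((derivWithin γ' (timeInterval T) t).1 : H s).1 = _ := congrArg Prod.fst h
  ext x
  rw [mean_densityS]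
  simp only [S.smul_apply, S.sub_apply, jacS_apply, derivS_apply, densityS_apply]
  have hd := (((γ t).continuous_density (γ' t)).integral_hasStrictDerivAt 0 x).hasDerivAt
  have hd2 := (hd.const_mul (1 / 2)).sub
    ((((γ t).hasDerivAt_φ three_halves_lt x).const_mul (1 / 2)).mul_const
      (∫ y in (0 : ℝ)..1, (γ t).density (γ' t) y))
  rw [h1]
  have e := hd2.deriv
  refine (congrArg Complex.ofReal e).trans ?_
  push_cast
  ring

/-- Conservation of `φₓ α_t`. -/
theorem jacS_mul_ofH (hs : 5 / 2 < s) (hγ : IsGeodesic s T γ γ') {t : ℝ}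
    (ht : t ∈ timeInterval T) :
    (jacS (γ t).h * ofH (γ' t).2 : S (s - 1)) = jacS (γ 0).h * ofH (γ' 0).2 := by
  refine eq_initial_of_hasDerivWithinAt_zero
    (f := fun τ => (jacS (γ τ).h * ofH (γ' τ).2 : S (s - 1))) (fun τ hτ => ?_) ht
  refine ((hγ.hasDerivWithinAt_jacS hτ).mul (hγ.hasDerivWithinAt_ofH hτ)).congr_deriv ?_
  rw [hγ.jacS_mul_accel hs hτ]
  ring

/-- The energy density satisfies `K_t = -(∫ K) φ_tx`. -/
theorem hasDerivWithinAt_densityS (hs : 5 / 2 < s) (hγ : IsGeodesic s T γ γ') {t : ℝ}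
    (ht : t ∈ timeInterval T) :
    HasDerivWithinAt (fun τ => densityS (γ τ) (γ' τ))
      (-(S.mean (densityS (γ t) (γ' t)) • derivS (γ' t).1)) (timeInterval T) t := by
  have hu := Ring.mul_inverse_cancel _ (isUnit_jacS (γ t))
  have hV := hγ.hasDerivWithinAt_derivS ht
  have hP := (hγ.hasDerivWithinAt_jacS ht).mul (hγ.hasDerivWithinAt_ofH ht)
  have hI := hasDerivWithinAt_ringInverse (isUnit_jacS (γ t)) (hγ.hasDerivWithinAt_jacS ht)
  refine (((hV.pow 2).add (hP.pow 2)).mul hI).congr_deriv ?_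
  rw [hγ.derivS_accel hs ht, hγ.jacS_mul_accel hs ht]
  generalize hE : S.mean (densityS (γ t) (γ' t)) = E
  simp only [densityS, Pi.add_apply, Pi.pow_apply, Pi.mul_apply]
  generalize (jacS (γ t).h : S (s - 1)) = J at hu
  generalize Ring.inverse J = R at hu
  generalize (derivS (γ' t).1 : S (s - 1)) = V
  generalize (ofH (γ' t).2 : S (s - 1)) = a
  ext x
  have hux : J x * R x = 1 := congrArg (fun f : S (s - 1) => f x) hu
  simp only [S.add_apply, S.mul_apply, S.pow_apply, S.neg_apply, S.smul_apply, S.sub_apply]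
  have h2 : ((2 : ℕ) : S (s - 1)) x = 2 := by
    rw [Nat.cast_ofNat, ← one_add_one_eq_two, S.add_apply, S.one_apply]
    norm_num
  rw [h2]
  linear_combination (-E * V x) * hux

theorem mean_densityS_eq (hs : 5 / 2 < s) (hγ : IsGeodesic s T γ γ') {t : ℝ}
    (ht : t ∈ timeInterval T) :
    S.mean (densityS (γ t) (γ' t)) = S.mean (densityS (γ 0) (γ' 0)) := by
  refine eq_initial_of_hasDerivWithinAt_zero
    (f := fun τ => S.mean (densityS (γ τ) (γ' τ))) (fun τ hτ => ?_) ht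
  refine ((S.mean (σ := s - 1)).restrictScalars ℝ).hasFDerivAt.comp_hasDerivWithinAt τ
    (hγ.hasDerivWithinAt_densityS hs hτ) |>.congr_deriv ?_
  rw [ContinuousLinearMap.coe_restrictScalars', map_neg, map_smul, mean_derivS, smul_zero, neg_zero]

variable {u₀ : H₀ s} {ρ₀ : H (s - 1)} {c : ℝ}

/-- The energy of a geodesic with initial velocity `(u₀, ρ₀)` is conserved. -/
theorem integral_density (hs : 5 / 2 < s) (hγ : IsGeodesic s T γ γ') (h0 : γ 0 = G.one s)
    (h1 : γ' 0 = (u₀, ρ₀))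
    (hc2 : c ^ 2 = (1 / 4) * ∫ x in (0 : ℝ)..1, ((deriv (u₀ : H s) x) ^ 2 + (ρ₀ x) ^ 2))
    {t : ℝ} (ht : t ∈ timeInterval T) :
    ∫ x in (0 : ℝ)..1, (γ t).density (γ' t) x = 4 * c ^ 2 := by
  have h := hγ.mean_densityS_eq hs ht
  rw [mean_densityS, mean_densityS] at h
  rw [Complex.ofReal_injective h, hc2, h1, h0]
  simp only [G.density, G.jac_one, div_one, mul_one]
  ring

/-- The Jacobian solves a harmonic oscillator equation, and is therefore the squared modulus of
the great circle. -/
theorem jac_eq (hs : 5 / 2 < s) (hγ : IsGeodesic s T γ γ') (h0 : γ 0 = G.one s)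
    (h1 : γ' 0 = (u₀, ρ₀)) (hc : 0 < c)
    (hc2 : c ^ 2 = (1 / 4) * ∫ x in (0 : ℝ)..1, ((deriv (u₀ : H s) x) ^ 2 + (ρ₀ x) ^ 2))
    {t : ℝ} (ht : t ∈ timeInterval T) (x : ℝ) :
    (γ t).jac x = gcSq c (u₀ : H s) ρ₀ t x := by
  have hE : ∀ τ ∈ timeInterval T, S.mean (densityS (γ τ) (γ' τ)) = ((4 * c ^ 2 : ℝ) : ℂ) :=
    fun τ hτ => by rw [mean_densityS, hγ.integral_density hs h0 h1 hc2 hτ]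
  set K₀ := densityS (γ 0) (γ' 0) with hK₀
  have hJ0 : (jacS (γ 0).h : S (s - 1)) = 1 := by
    ext y; rw [jacS_apply, h0, G.jac_one]; simp
  have hK : ∀ τ ∈ timeInterval T, densityS (γ τ) (γ' τ) + (4 * c ^ 2) • jacS (γ τ).h =
      K₀ + (4 * c ^ 2) • 1 := by
    intro τ hτ
    have := eq_initial_of_hasDerivWithinAt_zero
      (f := fun τ => densityS (γ τ) (γ' τ) + (4 * c ^ 2) • jacS (γ τ).h) (fun τ hτ => by
        refine ((hγ.hasDerivWithinAt_densityS hs hτ).add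
          ((hγ.hasDerivWithinAt_jacS hτ).const_smul (4 * c ^ 2))).congr_deriv ?_
        rw [hE τ hτ]
        ext y
        simp only [S.add_apply, S.neg_apply, S.smul_apply, S.real_smul_apply, S.zero_apply]
        ring) hτ
    refine this.trans ?_
    rw [hJ0]
  let B : S (s - 1) := K₀ + (4 * c ^ 2) • 1
  have key := eq_of_oscillator (k := 2 * c) (by positivity)
    (y := fun τ => jacS (γ τ).h - (8 * c ^ 2)⁻¹ • B) (v := fun τ => derivS (γ' τ).1)
    (fun τ hτ => (hγ.hasDerivWithinAt_jacS hτ).sub_const _) (fun τ hτ => by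
      refine (hγ.hasDerivWithinAt_derivS hτ).congr_deriv ?_
      rw [hγ.derivS_accel hs hτ, hE τ hτ]
      show _ = -(2 * c) ^ 2 • (jacS (γ τ).h - (8 * c ^ 2)⁻¹ • B)
      rw [show B = _ from (hK τ hτ).symm]
      ext y
      have : (c : ℂ) ≠ 0 := Complex.ofReal_ne_zero.mpr hc.ne'
      simp only [S.add_apply, S.sub_apply, S.smul_apply, S.real_smul_apply]
      push_cast
      field_simp
      ring) ht
  have kx := congrArg (fun f : S (s - 1) => f x) key
  simp only [S.add_apply, S.sub_apply, S.real_smul_apply, B, hK₀, densityS_apply, jacS_apply,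
    S.one_apply, h1, h0, derivS_apply, G.density, G.jac_one] at kx
  have kr : (γ t).jac x - (8 * c ^ 2)⁻¹ * ((deriv (u₀ : H s) x ^ 2 / 1 + ρ₀ x ^ 2 * 1) +
      4 * c ^ 2 * 1) = Real.cos (2 * c * t) * (1 - (8 * c ^ 2)⁻¹ *
      ((deriv (u₀ : H s) x ^ 2 / 1 + ρ₀ x ^ 2 * 1) + 4 * c ^ 2 * 1)) +
      Real.sin (2 * c * t) / (2 * c) * deriv (u₀ : H s) x := by exact_mod_cast kx
  rw [eq_add_of_sub_eq kr, gcSq, gcRe, gcIm, mul_assoc 2 c t, Real.cos_two_mul, Real.sin_two_mul]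
  have hs2 := Real.sin_sq (c * t)
  field_simp
  ring_nf
  rw [hs2]
  ring

end IsGeodesic

end Uniqueness

/-! ### The map `Φ` -/

theorem toCircle_coe_four_pi (y : ℝ) :
    (AddCircle.toCircle ((y : ℝ) : AddCircle (4 * Real.pi)) : ℂ) =
      Complex.exp ((y : ℂ) * (Complex.I / 2)) := by
  rw [AddCircle.toCircle_apply_mk, Circle.coe_exp]
  congr 1
  push_cast
  have : (Real.pi : ℂ) ≠ 0 := Complex.ofReal_ne_zero.mpr Real.pi_ne_zero
  field_simp
  ring

theorem Phi_apply {s : ℝ} (hs : 3 / 2 < s) (p : G s) (x : ℝ) :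
    Phi p x = (√(p.jac x) : ℂ) * (AddCircle.toCircle (p.α x) : ℂ) := by
  rw [Phi, (p.hasDerivAt_φ hs x).deriv]

theorem norm_Phi {s : ℝ} (hs : 3 / 2 < s) (p : G s) (x : ℝ) : ‖Phi p x‖ = √(p.jac x) := by
  rw [Phi_apply hs, norm_mul, Complex.norm_real, Circle.norm_coe, mul_one,
    Real.norm_of_nonneg (Real.sqrt_nonneg _)]

theorem H₀.eq_of_deriv_eq {s : ℝ} (hs : 3 / 2 < s) {f g : H₀ s}
    (h : ∀ x, deriv (f : H s) x = deriv (g : H s) x) : f = g := by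
  refine Subtype.ext (H.ext fun x => ?_)
  have hf := H.integral_deriv hs (f : H s) 0 x
  have hg := H.integral_deriv hs (g : H s) 0 x
  rw [H₀.apply_zero, sub_zero] at hf hg
  rw [← hf, ← hg]
  simp only [h]

theorem Phi_injective {s : ℝ} (hs : 3 / 2 < s) : Function.Injective (Phi (s := s)) := by
  intro p q hpq
  have hj : ∀ x, p.jac x = q.jac x := fun x => by
    have h := norm_Phi hs p x
    rw [hpq, norm_Phi hs q x] at h
    exact ((Real.sqrt_inj (q.jac_pos x).le (p.jac_pos x).le).mp h).symm
  refine G.ext (H₀.eq_of_deriv_eq hs fun x => add_left_cancel (hj x)) (funext fun x => ?_)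
  have h := congrFun hpq x
  rw [Phi_apply hs, Phi_apply hs, hj] at h
  have h0 : (√(q.jac x) : ℂ) ≠ 0 :=
    Complex.ofReal_ne_zero.mpr (Real.sqrt_pos.mpr (q.jac_pos x)).ne'
  exact AddCircle.injective_toCircle (by positivity) (Circle.ext (mul_left_cancel₀ h0 h))

/-- The angle `α` is determined modulo `4π` by `Φ`, as `√φₓ > 0`. -/
theorem α_eq_of_Phi_eq {s : ℝ} (hs : 3 / 2 < s) {p : G s} {x : ℝ} {z : ℂ} (h : Phi p x = z) :
    p.α x = ((2 * Complex.arg z : ℝ) : AddCircle (4 * Real.pi)) := by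
  have hn := norm_Phi hs p x
  have hz := Complex.norm_mul_exp_arg_mul_I z
  rw [h] at hn
  rw [Phi_apply hs, ← hn] at h
  have h0 : (‖z‖ : ℂ) ≠ 0 := by
    rw [hn]; exact Complex.ofReal_ne_zero.mpr (Real.sqrt_pos.mpr (p.jac_pos x)).ne'
  have he := mul_left_cancel₀ h0 (h.trans hz.symm)
  refine AddCircle.injective_toCircle (T := 4 * Real.pi) (by positivity) (Circle.ext ?_)
  rw [he, toCircle_coe_four_pi]
  congr 1
  push_cast
  ring

section

variable {s : ℝ} [hσ : Fact (1 / 2 < s - 1)] {T : ℝ≥0∞} {γ : ℝ → G s} {γ' : ℝ → TG s}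
  {u₀ : H₀ s} {ρ₀ : H (s - 1)} {c : ℝ}

/-- The factor `e^{iα/2}` does not depend on the choice of a lift of `α`. -/
theorem HasVelocityWithinAt.hasDerivWithinAt_toCircle {v : TG s} {I : Set ℝ} {t : ℝ}
    (h : HasVelocityWithinAt γ v I t) (ht : t ∈ I) (x : ℝ) :
    HasDerivWithinAt (fun τ => (AddCircle.toCircle ((γ τ).α x) : ℂ))
      (AddCircle.toCircle ((γ t).α x) * ((v.2 x : ℂ) * (Complex.I / 2))) I t := by
  obtain ⟨β, h0, hev, hd⟩ := h.snd
  have hB : HasDerivWithinAt (fun τ => ((β τ x : ℝ) : ℂ)) (v.2 x) I t :=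
    (((S.eval (σ := s - 1) x).restrictScalars ℝ).comp
      (ofH (σ := s - 1))).hasFDerivAt.comp_hasDerivWithinAt t hd
  have hE := ((hB.mul_const (Complex.I / 2)).cexp).const_mul
    (AddCircle.toCircle ((γ t).α x) : ℂ)
  have hβ : (β t x : ℂ) = 0 := by rw [h0]; rfl
  rw [hβ, zero_mul, Complex.exp_zero, one_mul] at hE
  refine hE.congr_of_eventuallyEq_of_mem ?_ ht
  filter_upwards [hev] with τ hτ
  rw [hτ x, AddCircle.toCircle_add, Circle.coe_mul, toCircle_coe_four_pi]

namespace IsGeodesic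

theorem hasDerivWithinAt_jac (hγ : IsGeodesic s T γ γ') {t : ℝ} (ht : t ∈ timeInterval T) (x : ℝ) :
    HasDerivWithinAt (fun τ => (γ τ).jac x) (deriv ((γ' t).1 : H s) x) (timeInterval T) t := by
  have h := (Complex.reCLM.comp
    ((S.eval (σ := s - 1) x).restrictScalars ℝ)).hasFDerivAt.comp_hasDerivWithinAt t
    (hγ.hasDerivWithinAt_jacS ht)
  refine h.congr (fun τ _ => ?_) ?_ <;> simp [jacS_apply]

/-- Along a geodesic `Φ` traces a great circle: both `√φₓ e^{iα/2}` and the great circle solve the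
same linear equation `2 φₓ w_t = (φ_tx + i φₓ α_t) w`, so their quotient is constant. -/
theorem Phi_eq (hs : 5 / 2 < s) (hγ : IsGeodesic s T γ γ') (h0 : γ 0 = G.one s)
    (h1 : γ' 0 = (u₀, ρ₀)) (hc : 0 < c)
    (hc2 : c ^ 2 = (1 / 4) * ∫ x in (0 : ℝ)..1, ((deriv (u₀ : H s) x) ^ 2 + (ρ₀ x) ^ 2))
    {t : ℝ} (ht : t ∈ timeInterval T) :
    Phi (γ t) = greatCircle c (u₀ : H s) ρ₀ t := by
  ext x
  have hj := fun τ hτ => hγ.jac_eq hs h0 h1 hc hc2 (t := τ) hτ x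
  have hf0 : ∀ τ ∈ timeInterval T, greatCircle c (u₀ : H s) ρ₀ τ x ≠ 0 := fun τ hτ =>
    (greatCircle_ne_zero_iff _ _ _ _ _).mpr (hj τ hτ ▸ (γ τ).jac_pos x)
  have hconst := eq_initial_of_hasDerivWithinAt_zero (T := T)
    (f := fun τ => (√((γ τ).jac x) : ℂ) * (AddCircle.toCircle ((γ τ).α x) : ℂ) /
      greatCircle c (u₀ : H s) ρ₀ τ x) (fun τ hτ => ?_) ht
  · rw [Phi_apply three_halves_lt]
    have e0 : greatCircle c (u₀ : H s) ρ₀ 0 x = 1 := by simp [greatCircle]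
    have e1 : (G.one s).α x = 0 := rfl
    simp only [e0, e1, h0, G.jac_one, Real.sqrt_one, AddCircle.toCircle_zero, Circle.coe_one,
      Complex.ofReal_one, mul_one, div_one] at hconst
    exact eq_of_div_eq_one hconst
  · have hjτ := (γ τ).jac_pos x
    have ha := congrArg (fun f : S (s - 1) => f x) (hγ.jacS_mul_ofH hs hτ)
    simp only [S.mul_apply, jacS_apply, ofH_apply, h0, h1, G.jac_one, Complex.ofReal_one,
      one_mul] at ha
    have dj := hγ.hasDerivWithinAt_jac hτ x
    have dX := (hasDerivAt_gcRe c (u₀ : H s) τ x)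
    have dY := (hasDerivAt_gcIm c ρ₀ τ x)
    have hv : deriv ((γ' τ).1 : H s) x = _ :=
      (uniqueDiffOn_timeInterval hγ.pos τ hτ).eq_deriv _
        (dj.congr (fun r hr => (hj r hr).symm) (hj τ hτ).symm)
        ((dX.pow 2).add (dY.pow 2)).hasDerivWithinAt
    have dF : HasDerivAt (fun r => greatCircle c (u₀ : H s) ρ₀ r x) _ τ :=
      (dX.ofReal_comp.add (dY.ofReal_comp.mul_const Complex.I)).congr_of_eventuallyEq
        (Eventually.of_forall fun r => greatCircle_eq _ _ _ _ _)
    have de := (hγ.velocity τ hτ).hasDerivWithinAt_toCircle hτ x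
    have dsq := (dj.sqrt hjτ.ne').ofReal_comp
    refine ((dsq.mul de).div dF.hasDerivWithinAt (hf0 τ hτ)).congr_deriv ?_
    have key : ((deriv ((γ' τ).1 : H s) x : ℝ) : ℂ) * greatCircle c (u₀ : H s) ρ₀ τ x +
        (ρ₀ x : ℂ) * Complex.I * greatCircle c (u₀ : H s) ρ₀ τ x =
        2 * ((γ τ).jac x : ℂ) * (((-(c * Real.sin (c * τ)) +
          deriv (u₀ : H s) x / (2 * c) * (c * Real.cos (c * τ)) : ℝ) : ℂ) +
          ((ρ₀ x / (2 * c) * (c * Real.cos (c * τ)) : ℝ) : ℂ) * Complex.I) := by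
      have hρ : ρ₀ x = 2 * (gcRe c (u₀ : H s) τ x * (ρ₀ x / (2 * c) * (c * Real.cos (c * τ))) -
          gcIm c ρ₀ τ x * (-(c * Real.sin (c * τ)) +
          deriv (u₀ : H s) x / (2 * c) * (c * Real.cos (c * τ)))) := by
        have := Real.sin_sq (c * τ)
        unfold gcRe gcIm
        field_simp
        ring_nf
        rw [this]
        ring
      rw [hv, hj τ hτ, greatCircle_eq, gcSq]
      generalize gcRe c (u₀ : H s) τ x = X at hρ ⊢
      generalize gcIm c ρ₀ τ x = Y at hρ ⊢
      generalize -(c * Real.sin (c * τ)) + deriv (u₀ : H s) x / (2 * c) * (c * Real.cos (c * τ)) =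
        X' at hρ ⊢
      generalize ρ₀ x / (2 * c) * (c * Real.cos (c * τ)) = Y' at hρ ⊢
      rw [hρ]
      push_cast
      linear_combination (2 * (X * Y' - Y * X') * Y : ℂ) * Complex.I_sq
    have hS0 : (√((γ τ).jac x) : ℂ) ≠ 0 :=
      Complex.ofReal_ne_zero.mpr (Real.sqrt_pos.mpr hjτ).ne'
    have hS : ((γ τ).jac x : ℂ) = (√((γ τ).jac x) : ℂ) ^ 2 := by
      rw [← Complex.ofReal_pow, Real.sq_sqrt hjτ.le]
    rw [← ha, hS] at key
    rw [div_eq_zero_iff]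
    left
    rw [Pi.mul_apply, Complex.ofReal_div, Complex.ofReal_mul, Complex.ofReal_ofNat]
    generalize -(c * Real.sin (c * τ)) + deriv (u₀ : H s) x / (2 * c) * (c * Real.cos (c * τ)) =
      X' at key ⊢
    generalize ρ₀ x / (2 * c) * (c * Real.cos (c * τ)) = Y' at key ⊢
    field_simp
    linear_combination (AddCircle.toCircle ((γ τ).α x) : ℂ) * key

end IsGeodesic

end

/-! ### The first zero of the great circle -/

theorem gcSq_nonneg (c : ℝ) (u₀ ρ₀ : ℝ → ℝ) (t x : ℝ) : 0 ≤ gcSq c u₀ ρ₀ t x := by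
  unfold gcSq; positivity

/-- The first time at which the great circle `cos ct + (u₀ₓ + iρ₀)/(2c) sin ct` vanishes somewhere
on the circle. -/
def maxTime (c : ℝ) (u₀ ρ₀ : ℝ → ℝ) : ℝ≥0∞ :=
  sInf {τ | ∃ t : ℝ, 0 ≤ t ∧ (∃ x, gcSq c u₀ ρ₀ t x = 0) ∧ τ = ENNReal.ofReal t}

theorem gcSq_pos_of_mem {c : ℝ} {u₀ ρ₀ : ℝ → ℝ} {t : ℝ}
    (ht : t ∈ timeInterval (maxTime c u₀ ρ₀)) (x : ℝ) : 0 < gcSq c u₀ ρ₀ t x := by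
  refine (gcSq_nonneg _ _ _ _ _).lt_of_ne fun h => ?_
  exact ht.2.not_ge (sInf_le ⟨t, ht.1, ⟨x, h.symm⟩, rfl⟩)

theorem le_maxTime {c : ℝ} {u₀ ρ₀ : ℝ → ℝ} {T : ℝ≥0∞}
    (h : ∀ t ∈ timeInterval T, ∀ x, 0 < gcSq c u₀ ρ₀ t x) : T ≤ maxTime c u₀ ρ₀ := by
  refine le_sInf ?_
  rintro _ ⟨t, h0, ⟨x, hx⟩, rfl⟩
  by_contra! hlt
  exact (h t ⟨h0, hlt⟩ x).ne' hx

/-- The great circle vanishes at some point and time if and only if `ρ₀` vanishes at some point: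
where `ρ₀ = 0`, the great circle is real-valued and moves from `1` to `-1` in the time `π/c`. -/
theorem maxTime_eq_top_iff {c : ℝ} (hc : 0 < c) (u₀ ρ₀ : ℝ → ℝ) :
    maxTime c u₀ ρ₀ = ⊤ ↔ ∀ x, ρ₀ x ≠ 0 := by
  constructor
  · intro h x hx
    have hcont : ContinuousOn (fun t => gcRe c u₀ t x) (Icc 0 (Real.pi / c)) :=
      fun t _ => (hasDerivAt_gcRe c u₀ t x).continuousAt.continuousWithinAt
    have h1 : gcRe c u₀ 0 x = 1 := by simp [gcRe]
    have h2 : gcRe c u₀ (Real.pi / c) x = -1 := by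
      rw [gcRe, mul_div_cancel₀ _ hc.ne']; simp
    obtain ⟨t, ht, hz⟩ := intermediate_value_Icc' (by positivity) hcont
      (show (0 : ℝ) ∈ _ by rw [h1, h2]; norm_num)
    have : gcSq c u₀ ρ₀ t x = 0 := by
      simp only at hz
      rw [gcSq, hz, gcIm, hx]; simp
    have hle : maxTime c u₀ ρ₀ ≤ ENNReal.ofReal t := sInf_le ⟨t, ht.1, ⟨x, this⟩, rfl⟩
    rw [h] at hle
    exact ENNReal.ofReal_ne_top (top_le_iff.mp hle)
  · intro h
    rw [eq_top_iff]
    refine le_maxTime fun t _ x => (gcSq_nonneg _ _ _ _ _).lt_of_ne fun h0 => ?_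
    have hre : gcRe c u₀ t x = 0 := by
      unfold gcSq at h0; nlinarith [sq_nonneg (gcRe c u₀ t x), sq_nonneg (gcIm c ρ₀ t x)]
    have him : gcIm c ρ₀ t x = 0 := by
      unfold gcSq at h0; nlinarith [sq_nonneg (gcRe c u₀ t x), sq_nonneg (gcIm c ρ₀ t x)]
    have hsin : Real.sin (c * t) = 0 := by
      rcases mul_eq_zero.mp him with h3 | h3
      · exact absurd h3 (div_ne_zero (h x) (by positivity))
      · exact h3
    rw [gcRe, hsin, mul_zero, add_zero] at hre
    have := Real.sin_sq_add_cos_sq (c * t)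
    rw [hsin, hre] at this
    norm_num at this

/-! ### The geodesic with given initial velocity -/

section

variable {s : ℝ} (c : ℝ) (u₀ w : H₀ s)

/-- The curve `h = φ - id` of the geodesic, where `w` is the primitive of `massDefect`. -/
def geoH (t : ℝ) : H₀ s :=
  Real.sin (c * t) ^ 2 • w + (Real.sin (c * t) * Real.cos (c * t) / c) • u₀

/-- The first component of the velocity of the geodesic. -/
def geoH' (t : ℝ) : H₀ s :=
  (2 * c * (Real.sin (c * t) * Real.cos (c * t))) • w +
    (Real.cos (c * t) ^ 2 - Real.sin (c * t) ^ 2) • u₀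

/-- The first component of the acceleration of the geodesic. -/
def geoH'' (t : ℝ) : H₀ s :=
  (2 * c ^ 2 * (Real.cos (c * t) ^ 2 - Real.sin (c * t) ^ 2)) • w +
    (-(4 * c * (Real.sin (c * t) * Real.cos (c * t)))) • u₀

variable {c} in
theorem hasDerivAt_geoH (hc : 0 < c) (t : ℝ) :
    HasDerivAt (geoH c u₀ w) (geoH' c u₀ w t) t := by
  have hcos := hasDerivAt_cos_mul c t
  have hsin := hasDerivAt_sin_mul c t
  refine (((hsin.pow 2).smul_const w).add
    (((hsin.mul hcos).div_const c).smul_const u₀)).congr_deriv ?_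
  rw [geoH']
  have := hc.ne'
  congr 2
  · push_cast; ring
  · field_simp; ring

theorem hasDerivAt_geoH' (t : ℝ) : HasDerivAt (geoH' c u₀ w) (geoH'' c u₀ w t) t := by
  have hcos := hasDerivAt_cos_mul c t
  have hsin := hasDerivAt_sin_mul c t
  refine ((((hsin.mul hcos).const_mul (2 * c)).smul_const w).add
    (((hcos.pow 2).sub (hsin.pow 2)).smul_const u₀)).congr_deriv ?_
  rw [geoH'']
  congr 2
  · ring
  · push_cast; ring

theorem contDiff_geoH : ContDiff ℝ ∞ (geoH c u₀ w) := by
  unfold geoH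
  fun_prop

theorem contDiff_geoH' : ContDiff ℝ ∞ (geoH' c u₀ w) := by
  unfold geoH'
  fun_prop

theorem geoH_apply (t x : ℝ) : (geoH c u₀ w t : H s) x = Real.sin (c * t) ^ 2 * (w : H s) x +
    Real.sin (c * t) * Real.cos (c * t) / c * (u₀ : H s) x := rfl

theorem geoH''_apply (t x : ℝ) : (geoH'' c u₀ w t : H s) x =
    2 * c ^ 2 * (Real.cos (c * t) ^ 2 - Real.sin (c * t) ^ 2) * (w : H s) x +
      -(4 * c * (Real.sin (c * t) * Real.cos (c * t))) * (u₀ : H s) x := rfl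

end

section

variable {s : ℝ} [hσ : Fact (1 / 2 < s - 1)]

theorem G.integral_jac (p : G s) (x : ℝ) : ∫ y in (0 : ℝ)..x, p.jac y = p.φ x := by
  rw [intervalIntegral.integral_eq_sub_of_hasDerivAt
    (fun y _ => p.hasDerivAt_φ three_halves_lt y)
    ((p.continuous_jac three_halves_lt).intervalIntegrable _ _), p.φ_zero, sub_zero]

theorem memSobolev_greatCircle (c : ℝ) (u₀ : H₀ s) (ρ₀ : H (s - 1)) (t : ℝ) :
    MemSobolev (s - 1) (greatCircle c (u₀ : H s) ρ₀ t) := by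
  have := S.mem ((Real.cos (c * t) : ℂ) • (1 : S (s - 1)) +
    ((Real.sin (c * t) / (2 * c) : ℝ) : ℂ) • (derivS u₀ + Complex.I • ofH ρ₀))
  convert this using 1
  ext x
  simp only [S.add_apply, S.smul_apply, S.one_apply, derivS_apply, ofH_apply, greatCircle]
  push_cast
  ring

variable (c : ℝ) (u₀ : H₀ s) (ρ₀ : H (s - 1))

/-- The function `(u₀ₓ² + ρ₀²)/(4c²) - 1`. -/
def massDefect : H (s - 1) :=
  reH (((4 * c ^ 2)⁻¹ : ℝ) • (derivS u₀ ^ 2 + ofH ρ₀ ^ 2) - 1)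

theorem massDefect_apply (x : ℝ) :
    massDefect c u₀ ρ₀ x = (4 * c ^ 2)⁻¹ * (deriv (u₀ : H s) x ^ 2 + ρ₀ x ^ 2) - 1 := by
  rw [massDefect, reH_apply]
  simp only [S.sub_apply, S.real_smul_apply, S.add_apply, S.pow_apply, derivS_apply, ofH_apply,
    S.one_apply]
  rw [← Complex.ofReal_pow, ← Complex.ofReal_pow, ← Complex.ofReal_add, ← Complex.ofReal_mul,
    Complex.sub_re, Complex.ofReal_re, Complex.one_re]

theorem integral_massDefect (hc : 0 < c)
    (hc2 : c ^ 2 = (1 / 4) * ∫ x in (0 : ℝ)..1, ((deriv (u₀ : H s) x) ^ 2 + (ρ₀ x) ^ 2)) :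
    ∫ x in (0 : ℝ)..1, massDefect c u₀ ρ₀ x = 0 := by
  simp only [massDefect_apply]
  rw [intervalIntegral.integral_sub, intervalIntegral.integral_const_mul,
    show (∫ x in (0 : ℝ)..1, ((deriv (u₀ : H s) x) ^ 2 + (ρ₀ x) ^ 2)) = 4 * c ^ 2 by linarith]
  · have := hc.ne'
    rw [intervalIntegral.integral_const, sub_zero, one_smul]
    field_simp
    norm_num
  · exact ((((u₀ : H s).continuous_deriv three_halves_lt).pow 2).add
      (ρ₀.continuous.pow 2)).const_mul _ |>.intervalIntegrable _ _
  · exact intervalIntegrable_const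

variable (w : H₀ s)

theorem deriv_geoH (t x : ℝ) : deriv (geoH c u₀ w t : H s) x =
    Real.sin (c * t) ^ 2 * deriv (w : H s) x +
      Real.sin (c * t) * Real.cos (c * t) / c * deriv (u₀ : H s) x := by
  have h := H.deriv_add (Real.sin (c * t) ^ 2 • (w : H s))
    ((Real.sin (c * t) * Real.cos (c * t) / c) • (u₀ : H s)) x
  rw [H.deriv_smul, H.deriv_smul] at h
  exact h

theorem deriv_geoH' (t x : ℝ) : deriv (geoH' c u₀ w t : H s) x =
    2 * c * (Real.sin (c * t) * Real.cos (c * t)) * deriv (w : H s) x +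
      (Real.cos (c * t) ^ 2 - Real.sin (c * t) ^ 2) * deriv (u₀ : H s) x := by
  have h := H.deriv_add ((2 * c * (Real.sin (c * t) * Real.cos (c * t))) • (w : H s))
    ((Real.cos (c * t) ^ 2 - Real.sin (c * t) ^ 2) • (u₀ : H s)) x
  rw [H.deriv_smul, H.deriv_smul] at h
  exact h

variable {c u₀ ρ₀ w}

theorem one_add_deriv_geoH (hc : 0 < c)
    (hw : ∀ x, deriv (w : H s) x = massDefect c u₀ ρ₀ x) (t x : ℝ) :
    1 + deriv (geoH c u₀ w t : H s) x = gcSq c (u₀ : H s) ρ₀ t x := by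
  rw [deriv_geoH, hw, massDefect_apply, gcSq, gcRe, gcIm]
  have := Real.cos_sq' (c * t)
  field_simp
  ring_nf
  rw [this]
  ring

end

section

variable {s : ℝ} [hσ : Fact (1 / 2 < s - 1)] {c : ℝ} {u₀ w : H₀ s} {ρ₀ : H (s - 1)}

variable (c u₀ w) in
/-- The Jacobian of the geodesic as a curve in `H^{s-1}(S¹; ℂ)`. -/
def geoJac (t : ℝ) : S (s - 1) := jacS (geoH c u₀ w t)

variable (c u₀ w ρ₀) in
/-- The velocity `α_t = ρ₀ / φₓ` as a curve in `H^{s-1}(S¹; ℂ)`. -/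
def geoRate (t : ℝ) : S (s - 1) := ofH ρ₀ * Ring.inverse (geoJac c u₀ w t)

variable (c u₀ w ρ₀) in
/-- The lift `∫₀ᵗ ρ₀ / φₓ` of the second component of the geodesic. -/
def geoLift (t : ℝ) : H (s - 1) := reH (∫ τ in (0 : ℝ)..t, geoRate c u₀ w ρ₀ τ)

theorem geoJac_apply (hc : 0 < c) (hw : ∀ x, deriv (w : H s) x = massDefect c u₀ ρ₀ x) (t x : ℝ) :
    geoJac c u₀ w t x = (gcSq c (u₀ : H s) ρ₀ t x : ℂ) := by
  rw [← one_add_deriv_geoH hc hw, geoJac, jacS]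
  simp

theorem isUnit_geoJac (hc : 0 < c) (hw : ∀ x, deriv (w : H s) x = massDefect c u₀ ρ₀ x) {t : ℝ}
    (ht : t ∈ timeInterval (maxTime c (u₀ : H s) ρ₀)) : IsUnit (geoJac c u₀ w t) :=
  S.isUnit_of_ne_zero fun x => by
    rw [geoJac_apply hc hw]; exact Complex.ofReal_ne_zero.mpr (gcSq_pos_of_mem ht x).ne'

theorem contDiff_geoJac : ContDiff ℝ ∞ (geoJac c u₀ w) :=
  contDiff_const.add ((derivS (s := s)).contDiff.comp (contDiff_geoH c u₀ w))

theorem contDiffAt_geoRate {t : ℝ} (ht : IsUnit (geoJac c u₀ w t)) :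
    ContDiffAt ℝ ∞ (geoRate c u₀ w ρ₀) t := by
  obtain ⟨u, hu⟩ := ht
  have h := contDiffAt_ringInverse ℝ (n := ∞) u
  rw [hu] at h
  exact contDiffAt_const.mul (h.comp t contDiff_geoJac.contDiffAt)

theorem isOpen_isUnit_geoJac : IsOpen {t | IsUnit (geoJac c u₀ w t)} :=
  Units.isOpen.preimage (contDiff_geoJac (c := c) (u₀ := u₀) (w := w)).continuous

/-- The first zero of the great circle occurs at a positive time, as the invertible elements of
the Banach algebra form a neighbourhood of `1`. -/
theorem maxTime_pos (hc : 0 < c) (hw : ∀ x, deriv (w : H s) x = massDefect c u₀ ρ₀ x) :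
    0 < maxTime c (u₀ : H s) ρ₀ := by
  have h0 : (0 : ℝ) ∈ {t | IsUnit (geoJac c u₀ w t)} := by
    have : geoJac c u₀ w 0 = 1 := by
      ext x; rw [geoJac_apply hc hw]; simp [gcSq, gcRe, gcIm]
    rw [mem_ofPred_eq, this]; exact isUnit_one
  obtain ⟨ε, hε, hb⟩ := Metric.isOpen_iff.mp isOpen_isUnit_geoJac 0 h0
  refine (ENNReal.ofReal_pos.mpr hε).trans_le (le_maxTime fun t ht x => ?_)
  have htε : t < ε := (ENNReal.ofReal_lt_ofReal_iff hε).mp ht.2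
  have hu : IsUnit (geoJac c u₀ w t) := hb (by
    rw [Metric.mem_ball, Real.dist_0_eq_abs, abs_of_nonneg ht.1]; exact htε)
  refine (gcSq_nonneg _ _ _ _ _).lt_of_ne fun hz => ?_
  have h1 := congrArg (fun f : S (s - 1) => f x) (Ring.mul_inverse_cancel _ hu)
  rw [S.mul_apply, geoJac_apply hc hw, ← hz] at h1
  simp at h1

theorem hasDerivAt_geoLift (hc : 0 < c) (hw : ∀ x, deriv (w : H s) x = massDefect c u₀ ρ₀ x)
    {t : ℝ} (ht : t ∈ timeInterval (maxTime c (u₀ : H s) ρ₀)) :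
    HasDerivAt (geoLift c u₀ w ρ₀) (reH (geoRate c u₀ w ρ₀ t)) t := by
  have hu := isUnit_geoJac hc hw ht
  have hint : IntervalIntegrable (geoRate c u₀ w ρ₀) volume 0 t := by
    refine ContinuousOn.intervalIntegrable fun τ hτ => ?_
    rw [uIcc_of_le ht.1] at hτ
    exact (contDiffAt_geoRate (isUnit_geoJac hc hw
      (mem_timeInterval_of_le ht hτ.1 hτ.2))).continuousAt.continuousWithinAt
  have hmeas := ContinuousOn.stronglyMeasurableAtFilter (μ := volume)
    (f := geoRate c u₀ w ρ₀) isOpen_isUnit_geoJac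
    (fun τ hτ => (contDiffAt_geoRate hτ).continuousAt.continuousWithinAt) t hu
  exact (reH (σ := s - 1)).hasFDerivAt.comp_hasDerivAt t
    (intervalIntegral.integral_hasDerivAt_right hint hmeas (contDiffAt_geoRate hu).continuousAt)

open Classical in
/-- The geodesic with initial velocity `(u₀, ρ₀)`, extended by `(id, 0)` to all times. -/
def geo (hc : 0 < c) (hw : ∀ x, deriv (w : H s) x = massDefect c u₀ ρ₀ x) (t : ℝ) : G s :=
  if ht : t ∈ timeInterval (maxTime c (u₀ : H s) ρ₀) then
    { h := geoH c u₀ w t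
      neg_one_lt_deriv := fun x => by
        have := gcSq_pos_of_mem ht x
        rw [← one_add_deriv_geoH hc hw] at this
        linarith
      α := fun x => ((geoLift c u₀ w ρ₀ t x : ℝ) : AddCircle (4 * Real.pi))
      exists_lift := ⟨0, geoLift c u₀ w ρ₀ t, fun x => by simp⟩ }
  else G.one s

variable (c u₀ w ρ₀) in
/-- The velocity of the geodesic. -/
def geo' (t : ℝ) : TG s := (geoH' c u₀ w t, reH (geoRate c u₀ w ρ₀ t))

theorem geo_h (hc : 0 < c) (hw : ∀ x, deriv (w : H s) x = massDefect c u₀ ρ₀ x) {t : ℝ}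
    (ht : t ∈ timeInterval (maxTime c (u₀ : H s) ρ₀)) :
    (geo hc hw t).h = geoH c u₀ w t := by rw [geo, dif_pos ht]

theorem geo_α (hc : 0 < c) (hw : ∀ x, deriv (w : H s) x = massDefect c u₀ ρ₀ x) {t : ℝ}
    (ht : t ∈ timeInterval (maxTime c (u₀ : H s) ρ₀)) (x : ℝ) :
    (geo hc hw t).α x = ((geoLift c u₀ w ρ₀ t x : ℝ) : AddCircle (4 * Real.pi)) := by
  rw [geo, dif_pos ht]

theorem hasVelocityWithinAt_geo (hc : 0 < c)
    (hw : ∀ x, deriv (w : H s) x = massDefect c u₀ ρ₀ x) {t : ℝ}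
    (ht : t ∈ timeInterval (maxTime c (u₀ : H s) ρ₀)) :
    HasVelocityWithinAt (geo hc hw) (geo' c u₀ w ρ₀ t)
      (timeInterval (maxTime c (u₀ : H s) ρ₀)) t where
  fst := (hasDerivAt_geoH u₀ w hc t).hasDerivWithinAt.congr (fun _ hτ => geo_h hc hw hτ)
    (geo_h hc hw ht)
  snd := by
    refine ⟨fun τ => geoLift c u₀ w ρ₀ τ - geoLift c u₀ w ρ₀ t, sub_self _, ?_,
      ((hasDerivAt_geoLift hc hw ht).sub_const _).hasDerivWithinAt⟩
    filter_upwards [self_mem_nhdsWithin] with τ hτ x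
    rw [geo_α hc hw hτ, geo_α hc hw ht, ← AddCircle.coe_add]
    congr 1
    exact (add_sub_cancel (geoLift c u₀ w ρ₀ t x) (geoLift c u₀ w ρ₀ τ x)).symm

theorem contDiffOn_geo' (hc : 0 < c) (hw : ∀ x, deriv (w : H s) x = massDefect c u₀ ρ₀ x) :
    ContDiffOn ℝ ∞ (geo' c u₀ w ρ₀) (timeInterval (maxTime c (u₀ : H s) ρ₀)) := fun t ht =>
  ((contDiff_geoH' c u₀ w).contDiffAt.prodMk ((reH (σ := s - 1)).contDiff.contDiffAt.comp t
    (contDiffAt_geoRate (isUnit_geoJac hc hw ht)))).contDiffWithinAt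

theorem hasDerivAt_geo' (hc : 0 < c) (hw : ∀ x, deriv (w : H s) x = massDefect c u₀ ρ₀ x) {t : ℝ}
    (ht : t ∈ timeInterval (maxTime c (u₀ : H s) ρ₀)) :
    HasDerivAt (geo' c u₀ w ρ₀) (geoH'' c u₀ w t,
      reH (ofH ρ₀ * -(Ring.inverse (geoJac c u₀ w t) ^ 2 * derivS (geoH' c u₀ w t)))) t := by
  refine (hasDerivAt_geoH' c u₀ w t).prodMk
    ((reH (σ := s - 1)).hasFDerivAt.comp_hasDerivAt t (HasDerivAt.const_mul _ ?_))
  rw [← hasDerivWithinAt_univ]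
  refine hasDerivWithinAt_ringInverse (isUnit_geoJac hc hw ht) (HasDerivAt.hasDerivWithinAt ?_)
  exact ((derivS (s := s)).hasFDerivAt.comp_hasDerivAt t (hasDerivAt_geoH u₀ w hc t)).const_add 1

theorem geo_jac (hc : 0 < c) (hw : ∀ x, deriv (w : H s) x = massDefect c u₀ ρ₀ x) {t : ℝ}
    (ht : t ∈ timeInterval (maxTime c (u₀ : H s) ρ₀)) (x : ℝ) :
    (geo hc hw t).jac x = gcSq c (u₀ : H s) ρ₀ t x := by
  rw [G.jac, geo_h hc hw ht, one_add_deriv_geoH hc hw]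

theorem geo'_snd_apply (hc : 0 < c) (hw : ∀ x, deriv (w : H s) x = massDefect c u₀ ρ₀ x) {t : ℝ}
    (ht : t ∈ timeInterval (maxTime c (u₀ : H s) ρ₀)) (x : ℝ) :
    (geo' c u₀ w ρ₀ t).2 x = ρ₀ x / gcSq c (u₀ : H s) ρ₀ t x := by
  rw [geo', reH_apply, geoRate, S.mul_apply, S.inverse_apply (isUnit_geoJac hc hw ht),
    geoJac_apply hc hw, ofH_apply, ← Complex.ofReal_inv, ← Complex.ofReal_mul, Complex.ofReal_re,
    div_eq_mul_inv]

/-- The energy density along the explicit curve; its `x`-dependence is affine in `massDefect` and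
`u₀ₓ`, so that it can be integrated in closed form. -/
theorem density_geo (hc : 0 < c) (hw : ∀ x, deriv (w : H s) x = massDefect c u₀ ρ₀ x) {t : ℝ}
    (ht : t ∈ timeInterval (maxTime c (u₀ : H s) ρ₀)) (x : ℝ) :
    (geo hc hw t).density (geo' c u₀ w ρ₀ t) x =
      4 * c ^ 2 * (1 + Real.cos (c * t) ^ 2 * deriv (w : H s) x -
        Real.sin (c * t) * Real.cos (c * t) / c * deriv (u₀ : H s) x) := by
  have hj := gcSq_pos_of_mem ht x
  have hρ : ρ₀ x ^ 2 = 4 * c ^ 2 * (deriv (w : H s) x + 1) - deriv (u₀ : H s) x ^ 2 := by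
    rw [hw, massDefect_apply]
    have := hc.ne'
    field_simp
    ring
  rw [G.density, geo_jac hc hw ht, geo'_snd_apply hc hw ht]
  have e : deriv ((geo' c u₀ w ρ₀ t).1 : H s) x = _ := deriv_geoH' c u₀ w t x
  rw [e]
  have hJ := one_add_deriv_geoH hc hw t x
  rw [deriv_geoH] at hJ
  rw [div_pow, hρ]
  have hj' := hj.ne'
  have h1 := Real.cos_sq_add_sin_sq (c * t)
  rw [← hJ] at hj' ⊢
  obtain ⟨q, hq⟩ : ∃ q, deriv (u₀ : H s) x = c * q := ⟨_, (mul_div_cancel₀ _ hc.ne').symm⟩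
  rw [hq] at hj' ⊢
  generalize deriv (w : H s) x = g at hj' ⊢
  generalize Real.sin (c * t) = S at hj' h1 ⊢
  generalize Real.cos (c * t) = C at hj' h1 ⊢
  have e1 : ∀ r : ℝ, r / c * (c * q) = r * q := fun r => by field_simp [hc.ne']
  rw [e1] at hj' ⊢
  generalize hD : 1 + (S ^ 2 * g + S * C * q) = D at hj' ⊢
  field_simp
  rw [← hD]
  linear_combination (q ^ 2 * (C ^ 2 + S ^ 2 + 1) - 4 * g) * h1

theorem integral_density_geo (hc : 0 < c) (hw : ∀ x, deriv (w : H s) x = massDefect c u₀ ρ₀ x)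
    {t : ℝ} (ht : t ∈ timeInterval (maxTime c (u₀ : H s) ρ₀)) (x : ℝ) :
    ∫ y in (0 : ℝ)..x, (geo hc hw t).density (geo' c u₀ w ρ₀ t) y =
      4 * c ^ 2 * (x + Real.cos (c * t) ^ 2 * (w : H s) x -
        Real.sin (c * t) * Real.cos (c * t) / c * (u₀ : H s) x) := by
  have hd : ∀ y, HasDerivAt (fun y => 4 * c ^ 2 * (y + Real.cos (c * t) ^ 2 * (w : H s) y -
      Real.sin (c * t) * Real.cos (c * t) / c * (u₀ : H s) y))
      ((geo hc hw t).density (geo' c u₀ w ρ₀ t) y) y := fun y => by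
    rw [density_geo hc hw ht]
    exact (((hasDerivAt_id y).add (((w : H s).hasDerivAt three_halves_lt y).const_mul _)).sub
      (((u₀ : H s).hasDerivAt three_halves_lt y).const_mul _)).const_mul _
  rw [intervalIntegral.integral_eq_sub_of_hasDerivAt (fun y _ => hd y)
    ((G.continuous_density _ _).intervalIntegrable _ _), H₀.apply_zero, H₀.apply_zero]
  ring

theorem isGeodesic_geo (hs : 5 / 2 < s) (hc : 0 < c)
    (hw : ∀ x, deriv (w : H s) x = massDefect c u₀ ρ₀ x) :
    IsGeodesic s (maxTime c (u₀ : H s) ρ₀) (geo hc hw) (geo' c u₀ w ρ₀) where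
  pos := maxTime_pos hc hw
  velocity _ ht := hasVelocityWithinAt_geo hc hw ht
  smooth := contDiffOn_geo' hc hw
  equation t ht := by
    rw [(hasDerivAt_geo' hc hw ht).hasDerivWithinAt.derivWithin
      (uniqueDiffOn_timeInterval (maxTime_pos hc hw) t ht), G.christoffel_eq hs]
    refine Prod.ext (funext fun x => ?_) (funext fun x => ?_)
    · simp only [integral_density_geo hc hw ht, H₀.apply_one]
      show (geoH'' c u₀ w t : H s) x = _
      rw [geoH''_apply, G.φ, geo_h hc hw ht, geoH_apply]
      have := hc.ne'
      field_simp
      ring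
    · show (reH (ofH ρ₀ * -(Ring.inverse (geoJac c u₀ w t) ^ 2 * derivS (geoH' c u₀ w t))) :
        H (s - 1)) x = -(deriv (geoH' c u₀ w t : H s) x * (geo' c u₀ w ρ₀ t).2 x /
          (geo hc hw t).jac x)
      rw [geo_jac hc hw ht, geo'_snd_apply hc hw ht, reH_apply]
      simp only [S.mul_apply, S.neg_apply, S.pow_apply, S.inverse_apply (isUnit_geoJac hc hw ht),
        geoJac_apply hc hw, ofH_apply, derivS_apply]
      rw [← Complex.ofReal_inv, ← Complex.ofReal_pow, ← Complex.ofReal_mul, ← Complex.ofReal_neg,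
        ← Complex.ofReal_mul, Complex.ofReal_re]
      have := (gcSq_pos_of_mem ht x).ne'
      field_simp

theorem geo_zero (hc : 0 < c) (hw : ∀ x, deriv (w : H s) x = massDefect c u₀ ρ₀ x) :
    geo hc hw 0 = G.one s := by
  have h0 := zero_mem_timeInterval (maxTime_pos hc hw)
  refine G.ext ?_ (funext fun x => ?_)
  · rw [geo_h hc hw h0, geoH]
    simp
    rfl
  · rw [geo_α hc hw h0, geoLift, intervalIntegral.integral_same, map_zero]
    rfl

theorem geo'_zero : geo' c u₀ w ρ₀ 0 = (u₀, ρ₀) := by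
  have h : geoJac c u₀ w 0 = 1 := by
    rw [geoJac, jacS, geoH]; simp
  refine Prod.ext ?_ (H.ext fun x => ?_)
  · show geoH' c u₀ w 0 = u₀
    rw [geoH']; simp
  · show (reH (geoRate c u₀ w ρ₀ 0) : H (s - 1)) x = ρ₀ x
    rw [geoRate, h, Ring.inverse_one, mul_one, reH_apply, ofH_apply, Complex.ofReal_re]

/-! ### Maximality and the existence time -/

variable {T : ℝ≥0∞} {γ δ : ℝ → G s} {γ' δ' : ℝ → TG s}

theorem HasVelocityWithinAt.unique {v v' : TG s} {I : Set ℝ} {t : ℝ}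
    (h : HasVelocityWithinAt γ v I t) (h' : HasVelocityWithinAt δ v' I t) (he : EqOn δ γ I)
    (ht : t ∈ I) (hu : UniqueDiffWithinAt ℝ I t) : v = v' := by
  refine Prod.ext ?_ (H.ext fun x => ?_)
  · exact hu.eq_deriv _ h.fst
      (h'.fst.congr (fun τ hτ => by rw [he hτ]) (by rw [he ht]))
  · have e := hu.eq_deriv _ (h.hasDerivWithinAt_toCircle ht x)
      ((h'.hasDerivWithinAt_toCircle ht x).congr (fun τ hτ => by rw [he hτ]) (by rw [he ht]))
    rw [he ht] at e
    have e2 := mul_right_cancel₀ (div_ne_zero Complex.I_ne_zero two_ne_zero)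
      (mul_left_cancel₀ (Circle.coe_ne_zero _) e)
    exact Complex.ofReal_injective e2

/-- The great circle does not vanish during the lifetime of the geodesic. -/
theorem IsGeodesic.le_maxTime (hs : 5 / 2 < s) (hγ : IsGeodesic s T γ γ') (h0 : γ 0 = G.one s)
    (h1 : γ' 0 = (u₀, ρ₀)) (hc : 0 < c)
    (hc2 : c ^ 2 = (1 / 4) * ∫ x in (0 : ℝ)..1, ((deriv (u₀ : H s) x) ^ 2 + (ρ₀ x) ^ 2)) :
    T ≤ maxTime c (u₀ : H s) ρ₀ :=
  HunterSaxton.le_maxTime fun _ ht x => hγ.jac_eq hs h0 h1 hc hc2 ht x ▸ (γ _).jac_pos x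

/-- An extension of the explicit geodesic has the same initial velocity, so that it is again subject
to `IsGeodesic.le_maxTime`. -/
theorem isMaximalGeodesicFrom_geo (hs : 5 / 2 < s) (hc : 0 < c)
    (hc2 : c ^ 2 = (1 / 4) * ∫ x in (0 : ℝ)..1, ((deriv (u₀ : H s) x) ^ 2 + (ρ₀ x) ^ 2))
    (hw : ∀ x, deriv (w : H s) x = massDefect c u₀ ρ₀ x) :
    IsMaximalGeodesicFrom s (u₀ : H s) ρ₀ (maxTime c (u₀ : H s) ρ₀) (geo hc hw)
      (geo' c u₀ w ρ₀) where
  isGeodesic := isGeodesic_geo hs hc hw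
  position_zero := geo_zero hc hw
  velocity_zero := by rw [geo'_zero]; rfl
  maximal T' δ δ' hδ he := by
    have hg := isGeodesic_geo hs hc hw
    have hm : 0 < min T' (maxTime c (u₀ : H s) ρ₀) := lt_min hδ.pos hg.pos
    have hi1 := timeInterval_mono (min_le_left T' (maxTime c (u₀ : H s) ρ₀))
    have hi2 := timeInterval_mono (min_le_right T' (maxTime c (u₀ : H s) ρ₀))
    have h0 := zero_mem_timeInterval hm
    have hv := ((hg.velocity 0 (hi2 h0)).mono hi2).unique ((hδ.velocity 0 (hi1 h0)).mono hi1)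
      (he.mono hi2) h0 (uniqueDiffOn_timeInterval hm 0 h0)
    exact hδ.le_maxTime hs ((he (hi2 h0)).trans (geo_zero hc hw)) (hv.symm.trans geo'_zero) hc hc2

theorem exists_isMaximalGeodesicFrom (hs : 5 / 2 < s) (hc : 0 < c)
    (hc2 : c ^ 2 = (1 / 4) * ∫ x in (0 : ℝ)..1, ((deriv (u₀ : H s) x) ^ 2 + (ρ₀ x) ^ 2)) :
    ∃ (γ : ℝ → G s) (γ' : ℝ → TG s),
      IsMaximalGeodesicFrom s (u₀ : H s) ρ₀ (maxTime c (u₀ : H s) ρ₀) γ γ' :=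
  ⟨_, _, isMaximalGeodesicFrom_geo hs hc hc2
    (H.deriv_primitive _ (integral_massDefect c u₀ ρ₀ hc hc2))⟩

/-- Every maximal geodesic exists until the first zero of the great circle. -/
theorem IsMaximalGeodesicFrom.eq_maxTime (hs : 5 / 2 < s) (hc : 0 < c)
    (hc2 : c ^ 2 = (1 / 4) * ∫ x in (0 : ℝ)..1, ((deriv (u₀ : H s) x) ^ 2 + (ρ₀ x) ^ 2))
    (h : IsMaximalGeodesicFrom s (u₀ : H s) ρ₀ T γ γ') : T = maxTime c (u₀ : H s) ρ₀ := by
  have h1 : γ' 0 = (u₀, ρ₀) := TG.ext_fn h.velocity_zero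
  have hle := h.isGeodesic.le_maxTime hs h.position_zero h1 hc hc2
  refine le_antisymm hle ?_
  obtain ⟨δ, δ', hδ⟩ := exists_isMaximalGeodesicFrom hs hc hc2
  refine h.maximal _ δ δ' hδ.isGeodesic fun t ht => Phi_injective three_halves_lt ?_
  rw [h.isGeodesic.Phi_eq hs h.position_zero h1 hc hc2 ht,
    hδ.isGeodesic.Phi_eq hs hδ.position_zero (TG.ext_fn hδ.velocity_zero) hc hc2
      (timeInterval_mono hle ht)]

theorem G.greatCircle_mem_sphereU {p : G s} {t : ℝ}
    (h : Phi p = greatCircle c (u₀ : H s) ρ₀ t) :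
    greatCircle c (u₀ : H s) ρ₀ t ∈ sphereU (s - 1) := by
  refine ⟨memSobolev_greatCircle c u₀ ρ₀ t, ?_, fun x => ?_⟩
  · rw [← h]
    simp only [norm_Phi three_halves_lt, Real.sq_sqrt (p.jac_pos _).le, p.integral_jac, p.φ_one]
  · rw [← h, ← norm_pos_iff, norm_Phi three_halves_lt]
    exact Real.sqrt_pos.mpr (p.jac_pos x)

end

end

end HunterSaxton

open HunterSaxton in
theorem corollary3p4 (s : ℝ) (hs : 5 / 2 < s) (u₀ : H₀ s) (ρ₀ : H (s - 1))
    (c : ℝ) (hc : 0 < c)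
    (hc2 : c ^ 2 = (1 / 4) * ∫ x in (0 : ℝ)..1, ((deriv (u₀ : H s) x) ^ 2 + (ρ₀ x) ^ 2)) :
    (∃ (T : ℝ≥0∞) (γ : ℝ → G s) (γ' : ℝ → TG s),
      IsMaximalGeodesicFrom s (u₀ : H s) ρ₀ T γ γ') ∧
    ∀ (T : ℝ≥0∞) (γ : ℝ → G s) (γ' : ℝ → TG s),
      IsMaximalGeodesicFrom s (u₀ : H s) ρ₀ T γ γ' →
      -- the speed of the geodesic is `c`
      (∀ t ∈ timeInterval T, metric (γ t) (γ' t) (γ' t) = c ^ 2) ∧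
      -- `γ(t) = Φ⁻¹(cos ct + (u₀ₓ + iρ₀)/(2c) sin ct)`
      (∀ t ∈ timeInterval T,
        greatCircle c (u₀ : H s) ρ₀ t ∈ sphereU (s - 1) ∧
        Phi (γ t) = greatCircle c (u₀ : H s) ρ₀ t ∧
        ∀ p : G s, Phi p = greatCircle c (u₀ : H s) ρ₀ t → p = γ t) ∧
      -- the explicit formulas for `φ` and `α`
      (∀ t ∈ timeInterval T, ∀ x : ℝ,
        (γ t).φ x = ∫ y in (0 : ℝ)..x,
          ((Real.cos (c * t) + deriv (u₀ : H s) y / (2 * c) * Real.sin (c * t)) ^ 2 +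
            (ρ₀ y / (2 * c) * Real.sin (c * t)) ^ 2)) ∧
      (∀ t ∈ timeInterval T, ∀ x : ℝ,
        (γ t).α x = ((2 * Complex.arg (Real.cos (c * t) +
          (((deriv (u₀ : H s) x : ℝ) : ℂ) + Complex.I * (ρ₀ x : ℂ)) / (2 * c) * Real.sin (c * t)) : ℝ) :
            AddCircle (4 * Real.pi))) ∧
      -- the existence time does not depend on the Sobolev index
      (∀ r : ℝ, 5 / 2 < r → r ≤ s →
        (∃ (δ : ℝ → G r) (δ' : ℝ → TG r), IsMaximalGeodesicFrom r (u₀ : H s) ρ₀ T δ δ') ∧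
        ∀ (T' : ℝ≥0∞) (δ : ℝ → G r) (δ' : ℝ → TG r),
          IsMaximalGeodesicFrom r (u₀ : H s) ρ₀ T' δ δ' → T' = T) ∧
      -- criterion for global existence
      (T = ⊤ ↔ ∀ x : ℝ, ρ₀ x ≠ 0) := by
  have : Fact (1 / 2 < s - 1) := ⟨by linarith⟩
  refine ⟨⟨_, exists_isMaximalGeodesicFrom hs hc hc2⟩, fun T γ γ' h => ?_⟩
  have h0 := h.position_zero
  have h1 : γ' 0 = (u₀, ρ₀) := TG.ext_fn h.velocity_zero
  have hT := h.eq_maxTime hs hc hc2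
  have hΦ := fun t (ht : t ∈ timeInterval T) => h.isGeodesic.Phi_eq hs h0 h1 hc hc2 ht
  refine ⟨fun t ht => ?_, fun t ht => ⟨G.greatCircle_mem_sphereU (hΦ t ht), hΦ t ht, fun p hp =>
    Phi_injective three_halves_lt (hp.trans (hΦ t ht).symm)⟩, fun t ht x => ?_, fun t ht x =>
    α_eq_of_Phi_eq three_halves_lt (congrFun (hΦ t ht) x), fun r hr hrs => ?_, ?_⟩
  · rw [G.metric_eq hs, h.isGeodesic.integral_density hs h0 h1 hc2 ht]
    ring
  · rw [← G.integral_jac]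
    exact congrArg (fun f : ℝ → ℝ => ∫ y in (0 : ℝ)..x, f y)
      (funext fun y => h.isGeodesic.jac_eq hs h0 h1 hc hc2 ht y)
  · have : Fact (1 / 2 < r - 1) := ⟨by linarith⟩
    let u : H₀ r := ⟨⟨(u₀ : H s), MemSobolev.mono hrs (u₀ : H s).2⟩, u₀.2⟩
    let ρ : H (r - 1) := ⟨ρ₀, MemSobolev.mono (by linarith) ρ₀.2⟩
    obtain ⟨δ, δ', hδ⟩ := exists_isMaximalGeodesicFrom (u₀ := u) (ρ₀ := ρ) hr hc hc2
    rw [hT]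
    exact ⟨⟨δ, δ', hδ⟩, fun T' δ δ' h' =>
      IsMaximalGeodesicFrom.eq_maxTime (u₀ := u) (ρ₀ := ρ) hr hc hc2 h'⟩
  · rw [hT, maxTime_eq_top_iff hc]
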